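/- **Setting.** Let $T\ge 1$. Consider a stagewise independent multistage stochastic program with stages $0,\dots,T$: there is one root $r$ in stage $0$, and for $0\le t<T$ all nodes of stage $t$ have the same finite set $\tilde{\mathcal N}(t+1)$ of children $m$, with transition probabilities $p_m>0$, $\sum_{m\in\tilde{\mathcal N}(t+1)}p_m=1$, and with data depending only on $m$. The root has a feasibility set $\mathcal F_r$ of pairs $(x,y)$ and a cost $f_r(y,x)\in[0,\infty]$; a node $m\in\tilde{\mathcal N}(t+1)$ has a feasibility set $\mathcal F_m$ of pairs $(x,y)$ and a cost $f_m(z,y,x)\in[0,\infty]$, where $z$ is the parent's state. All variables live in finite-dimensional normed spaces; states of stage $t$ lie in $\mathbb R^{d_t}$ with a norm $\|\cdot\|$. For $t<T$ the projection of $\mathcal F_m$ to the state variable is the same set $\mathcal X_t\subset\mathbb R^{d_t}$ for all nodes $m$ of stage $t$. Assume: all feasibility sets are compact; $f_r$ is lower semicontinuous on $\mathcal F_r$, and $f_m$ on $\mathcal X_t\times\mathcal F_m$; some feasible decision on the full scenario tree has finite expected cost. For $m\in\tilde{\mathcal N}(t+1)$ let $\sigma_m>0$ and let $\psi_m\ge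 0$ be a penalty function ($\psi_m(x)=0$ iff $x=0$; the diameter of $\{\psi_m\le a\}$ tends to $0$ as $a\downarrow0$) that is $1$-Lipschitz on $\mathcal X_t-\mathcal X_t$. **Regularized problem.** Put $\mathcal Q^{\rm R}_T=0$ and, for $t<T$, $\mathcal Q^{\rm R}_t(x)=\sum_{m\in\tilde{\mathcal N}(t+1)}p_m\min\{f_m(z,y',x')+\sigma_m\psi_m(x-z)+\mathcal Q^{\rm R}_{t+1}(x'):(x',y')\in\mathcal F_m,\ z\in\mathcal X_t\}$, and $v^{\rm reg}=\min_{(x,y)\in\mathcal F_r}\{f_r(y,x)+\mathcal Q^{\rm R}_0(x)\}$. A root solution $(x,y)\in\mathcal F_r$ is $\eta$-optimal if $f_r(y,x)+\mathcal Q_0^{\rm R}(x)\le v^{\rm reg}+\eta$. Assume that the penalty reformulation is exact: every minimizer, over the full scenario tree, of the expected value of $f_r(y_r,x_r)$ plus the sum of $f_n(z_n,y_n,x_n)+\sigma_n\psi_n(x_{a(n)}-z_n)$ over the non-root nodes $n$ (subject to $(x_n,y_n)\in\mathcal F_n$ at all nodes and $z_n\in\mathcal X_{a(n)}$ at the non-root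 nodes) has $z_n=x_{a(n)}$ at all non-root nodes $n$, where $a(n)$ is the parent of $n$ and $\mathcal X_{a(n)}$ the state space of its stage. **Oracles.** Let $l_{m,\lambda},l_{m,\rho}\ge0$ be such that either $l_{m,\rho}\ge\sigma_m$ for all non-root $m$, or the problem is convex (all $\mathcal F_n$, $\mathcal X_t$, $f_n$, $\psi_m$ are convex) and $\psi_m=\|\cdot\|$, $l_{m,\lambda}\ge\sigma_m$, $l_{m,\rho}=0$ for all $m$. Let $\mathcal U_m=\{(\lambda,\rho):\|\lambda\|_*\le l_{m,\lambda},\ 0\le\rho\le l_{m,\rho}\}$. Given are oracles that return some optimal solution, for every $\Theta$ that is lower semicontinuous on the state space of the node and every parent state $\bar x\in\mathcal X_t$, of - (R) $\min_{(x,y)\in\mathcal F_r}\{f_r(y,x)+\Theta(x)\}$; - (F), for $m\in\tilde{\mathcal N}(t+1)$: $\min_{(x,y)\in\mathcal F_m,\,z\in\mathcal X_t}\{f_m(z,y,x)+\sigma_m\psi_m(\bar x-z)+\Theta(x)\}$; - (B), for $m\in\tilde{\mathcal N}(t+1)$: $\max_{(\lambda,\rho)\in\mathcal U_m}\min_{(x,y)\in\mathcal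 F_m,\,z\in\mathcal X_t}\{f_m(z,y,x)+\langle\lambda,\bar x-z\rangle+\rho\psi_m(\bar x-z)+\Theta(x)\}$. **Algorithm** (deterministic sampling dual dynamic programming), with a tolerance. Start with $\underline{\mathcal Q}^0_t=0$ for all $t$, $\overline{\mathcal Q}{}^0_t=+\infty$ for $t<T$, $\overline{\mathcal Q}{}^0_T=0$, $(x_0^1,y_0^1)$ from (R) with $\Theta=0$, $\mathrm{LB}=f_r(y_0^1,x_0^1)$, $\mathrm{UB}=+\infty$. While $\mathrm{UB}-\mathrm{LB}$ exceeds the tolerance, do iteration $i=1,2,\dots$: 1. For $t=1,\dots,T$ and every $m\in\tilde{\mathcal N}(t)$ let $(x_m^i,y_m^i,z_m^i)$ be the output of (F) for $\bar x=x_{t-1}^i$, $\Theta=\underline{\mathcal Q}_t^{i-1}$; if $t<T$, let $x_t^i=x_m^i$ for any $m$ with largest $\overline{\mathcal Q}{}_t^{i-1}(x_m^i)-\underline{\mathcal Q}_t^{i-1}(x_m^i)$. 2. Put $\underline{\mathcal Q}^i_T=\overline{\mathcal Q}{}^i_T=0$. For $t=T-1,\dots,0$ and every $m\in\tilde{\mathcal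 N}(t+1)$ let $(\hat x_m,\hat y_m,\hat z_m;\hat\lambda_m,\hat\rho_m)$ be the output of (B) for $\bar x=x_t^i$, $\Theta=\underline{\mathcal Q}_{t+1}^i$, and let $\underline v_m=f_m(\hat z_m,\hat y_m,\hat x_m)+\langle\hat\lambda_m,x_t^i-\hat z_m\rangle+\hat\rho_m\psi_m(x_t^i-\hat z_m)+\underline{\mathcal Q}_{t+1}^i(\hat x_m)$, $\overline v_m=f_m(z_m^i,y_m^i,x_m^i)+\sigma_m\psi_m(x_t^i-z_m^i)+\overline{\mathcal Q}{}_{t+1}^i(x_m^i)$; then put $$\underline{\mathcal Q}_t^i(x)=\max\Big\{\underline{\mathcal Q}_t^{i-1}(x),\ \sum_m p_m\big(-\langle\hat\lambda_m,x_t^i-x\rangle-\hat\rho_m\psi_m(x_t^i-x)+\underline v_m\big)\Big\},$$ $$\overline{\mathcal Q}{}_t^i(x)=\min\Big\{\overline{\mathcal Q}{}_t^{i-1}(x),\ \sum_m p_m\big(\overline v_m+\sigma_m\|x-x_t^i\|\big)\Big\},$$ the last function being replaced by its biconjugate $g^{**}(x)=\sup_\lambda\inf_z\{g(z)+\langle\lambda,x-z\rangle\}$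 on $\mathbb R^{d_t}$ if the problem is convex. 3. Let $(x_0^{i+1},y_0^{i+1})$ be the output of (R) for $\Theta=\underline{\mathcal Q}_0^i$, $\mathrm{LB}=f_r(y_0^{i+1},x_0^{i+1})+\underline{\mathcal Q}_0^i(x_0^{i+1})$; if $\mathrm{UB}>f_r(y_0^{i+1},x_0^{i+1})+\overline{\mathcal Q}{}_0^i(x_0^{i+1})$, let $\mathrm{UB}$ be this value and $(x_0^{i+1},y_0^{i+1})$ the incumbent. **Claim.** Let $L_t=\sum_{m\in\tilde{\mathcal N}(t+1)}p_m(l_{m,\lambda}+l_{m,\rho})$, and suppose that for all $0\le t\le T-1$ one has $L_t\le L$, $d_t\le d$ ($d$ an integer), and $\mathcal X_t$ is contained in a ball of diameter at most $D$. Then for every $\varepsilon>0$ the algorithm, run with tolerance $T\varepsilon$, terminates, after a number $i$ of iterations with $$i\le T\Big(1+\frac{2LD}{\varepsilon}\Big)^{d},$$ and its incumbent is then a $(T\varepsilon)$-optimal root solution of the regularized problem. (For fixed $L,D,\varepsilon,d$ the bound is linear in $T$.) -/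

import Mathlib

open Set Filter Topology
open scoped NNReal ENNReal Pointwise

universe u

noncomputable section

/-- Nodes of stage `t` of the scenario tree: the root for `t = 0`; a node of stage `t + 1` is a node
`w` of stage `t` (its parent) together with one of the children `m : N t`. -/
def ScenarioNode (N : ℕ → Type u) : ℕ → Type u
  | 0 => PUnit
  | t + 1 => ScenarioNode N t × N t

/-- There are finitely many scenario nodes in every stage. -/
instance ScenarioNode.instFintype {N : ℕ → Type u} [∀ t, Fintype (N t)] :
    ∀ t, Fintype (ScenarioNode N t)
  | 0 => inferInstanceAs (Fintype PUnit)
  | t + 1 => @instFintypeProd _ _ (ScenarioNode.instFintype t) _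

section Program

/-- A stagewise independent multistage stochastic program with stages `0, …, T`, given by its
recombining scenario tree.  The state variable of stage `t` lives in the finite-dimensional normed
space `E t`.  For `t < T`, `N t` indexes the children of any node of stage `t`, that is the nodes of
stage `t + 1` of the recombining tree; `p t m` is the transition probability to the child `m`, `F t m`
its feasibility set of pairs `(x, y)` (state and internal variable), `f t m z y x` its cost,
`σ t m * ψ t m (· - z)` the penalty term of its regularized nodal problem, and `lLam t m`, `lRho t m`
the bounds on its dual variables.  `F₀`, `f₀` are the data of the root, whose parent state is
the constant `0` and is not written.  `X t` with `t < T` is the state space of stage `t`.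
Data with index `t ≥ T` is irrelevant. -/
structure StagewiseProgram (E : ℕ → Type*) [∀ t, NormedAddCommGroup (E t)]
    [∀ t, NormedSpace ℝ (E t)] (N : ℕ → Type*) [∀ t, Fintype (N t)] (Yr : Type*)
    (Y : ∀ t, N t → Type*) where
  T : ℕ
  X : ∀ t, Set (E t)
  F₀ : Set (E 0 × Yr)
  f₀ : Yr → E 0 → ℝ≥0∞
  p : ∀ t, N t → ℝ
  F : ∀ t m, Set (E (t + 1) × Y t m)
  f : ∀ t m, E t → Y t m → E (t + 1) → ℝ≥0∞
  σ : ∀ t, N t → ℝ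
  ψ : ∀ t, N t → E t → ℝ
  lLam : ∀ t, N t → ℝ
  lRho : ∀ t, N t → ℝ
  p_pos : ∀ t < T, ∀ m, 0 < p t m
  p_sum : ∀ t < T, ∑ m, p t m = 1
  σ_pos : ∀ t < T, ∀ m, 0 < σ t m
  lLam_nonneg : ∀ t < T, ∀ m, 0 ≤ lLam t m
  lRho_nonneg : ∀ t < T, ∀ m, 0 ≤ lRho t m
  /-- the state space is the projection of the feasibility set, and it is the same for all
  nodes of a stage `t + 1 < T` -/
  X_zero : X 0 = Prod.fst '' F₀
  X_succ : ∀ t, t + 1 < T → ∀ m, X (t + 1) = Prod.fst '' F t m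

namespace StagewiseProgram

variable {E : ℕ → Type*} [∀ t, NormedAddCommGroup (E t)] [∀ t, NormedSpace ℝ (E t)]
  {N : ℕ → Type*} [∀ t, Fintype (N t)]
  {Yr : Type*} [NormedAddCommGroup Yr] [NormedSpace ℝ Yr]
  {Y : ∀ t, N t → Type*} [∀ t m, NormedAddCommGroup (Y t m)] [∀ t m, NormedSpace ℝ (Y t m)]
  (P : StagewiseProgram E N Yr Y)

/-! ### Extensive forms -/

/-- The probability of a node of the scenario tree. -/
def prob : ∀ t, ScenarioNode N t → ℝ
  | 0, _ => 1
  | t + 1, w => prob t w.1 * P.p t w.2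

/-- Decision variables of the extensive forms: states `x` at all nodes, internal variables `y₀` at the
root and `y`, and local copies `z` of the parent state, at all other nodes `(w, m)`. -/
structure Decision (P : StagewiseProgram E N Yr Y) where
  x : ∀ t, ScenarioNode N t → E t
  y₀ : Yr
  y : ∀ t, ScenarioNode N t → ∀ m, Y t m
  z : ∀ t, ScenarioNode N t → N t → E t

/-- `(x_n, y_n) ∈ F_n` at all nodes, and `z_n ∈ X_{a(n)}` at all nodes but the root. -/
def Decision.Feasible {P : StagewiseProgram E N Yr Y} (u : P.Decision) : Prop :=
  (u.x 0 PUnit.unit, u.y₀) ∈ P.F₀ ∧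
    ∀ t < P.T, ∀ w m, (u.x (t + 1) (w, m), u.y t w m) ∈ P.F t m ∧ u.z t w m ∈ P.X t

/-- Objective of the original extensive form (it does not involve `z`). -/
def Decision.cost {P : StagewiseProgram E N Yr Y} (u : P.Decision) : ℝ≥0∞ :=
  P.f₀ u.y₀ (u.x 0 PUnit.unit) +
    ∑ t ∈ Finset.range P.T, ∑ w : ScenarioNode N t, ∑ m : N t,
      ENNReal.ofReal (P.prob (t + 1) (w, m)) *
        P.f t m (u.x t w) (u.y t w m) (u.x (t + 1) (w, m))

/-- Objective of the penalty reformulation. -/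
def Decision.penalizedCost {P : StagewiseProgram E N Yr Y} (u : P.Decision) : ℝ≥0∞ :=
  P.f₀ u.y₀ (u.x 0 PUnit.unit) +
    ∑ t ∈ Finset.range P.T, ∑ w : ScenarioNode N t, ∑ m : N t,
      ENNReal.ofReal (P.prob (t + 1) (w, m)) *
        (P.f t m (u.z t w m) (u.y t w m) (u.x (t + 1) (w, m)) +
          ENNReal.ofReal (P.σ t m * P.ψ t m (u.x t w - u.z t w m)))

/-! ### Standing assumptions -/

/-- Compact feasibility sets, (nonnegative) lower semicontinuous costs, and a feasible decision of
finite cost. -/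
def MinCondition : Prop :=
  IsCompact P.F₀ ∧ LowerSemicontinuousOn (fun u : E 0 × Yr => P.f₀ u.2 u.1) P.F₀ ∧
  (∀ t < P.T, ∀ m, IsCompact (P.F t m) ∧
    LowerSemicontinuousOn (fun q : E t × (E (t + 1) × Y t m) => P.f t m q.1 q.2.2 q.2.1)
      (P.X t ×ˢ P.F t m)) ∧
  ∃ u : P.Decision, u.Feasible ∧ u.cost < ⊤

/-- A penalty function: nonnegative, vanishing exactly at `0`, with level sets whose diameter
tends to `0` with the level. -/
def _root_.IsPenaltyFunction {V : Type*} [NormedAddCommGroup V] (φ : V → ℝ) : Prop :=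
  (∀ x, 0 ≤ φ x) ∧ (∀ x, φ x = 0 ↔ x = 0) ∧
    Tendsto (fun a : ℝ => Metric.ediam {x | φ x ≤ a}) (𝓝[>] 0) (𝓝 0)

/-- Every `ψ` is a penalty function, scaled to be `1`-Lipschitz on the differences of states. -/
def PenaltyCondition : Prop :=
  ∀ t < P.T, ∀ m, IsPenaltyFunction (P.ψ t m) ∧ LipschitzOnWith 1 (P.ψ t m) (P.X t - P.X t)

/-- Exactness of the penalty reformulation: each of its optimal solutions has `z_n = x_{a(n)}` at
all nodes. -/
def ExactPenalty : Prop :=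
  ∀ u : P.Decision, u.Feasible →
    (∀ u' : P.Decision, u'.Feasible → u.penalizedCost ≤ u'.penalizedCost) →
    ∀ t < P.T, ∀ w m, u.z t w m = u.x t w

/-- The (regularized) problem is convex: convex sets, jointly convex extended-valued costs, convex
penalty functions. -/
def IsConvex : Prop :=
  Convex ℝ P.F₀ ∧ ConvexOn ℝ≥0 P.F₀ (fun u : E 0 × Yr => P.f₀ u.2 u.1) ∧
  ∀ t < P.T, ∀ m, Convex ℝ (P.X t) ∧ Convex ℝ (P.F t m) ∧
    ConvexOn ℝ≥0 (P.X t ×ˢ P.F t m)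
      (fun q : E t × (E (t + 1) × Y t m) => P.f t m q.1 q.2.2 q.2.1) ∧
    ConvexOn ℝ univ (P.ψ t m)

/-- Choice of the bounds on the dual variables: either the problem is convex, the penalty
functions are the norms, and the cuts are linear with `l_λ ≥ σ`, `l_ρ = 0`; or `l_ρ ≥ σ`. -/
def DualBoundCondition : Prop :=
  (P.IsConvex ∧ ∀ t < P.T, ∀ m,
    (∀ x, P.ψ t m x = ‖x‖) ∧ P.σ t m ≤ P.lLam t m ∧ P.lRho t m = 0) ∨
  ∀ t < P.T, ∀ m, P.σ t m ≤ P.lRho t m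

/-- The Lipschitz constant `L_t = ∑_m p_m (l_{m,λ} + l_{m,ρ})` of stage `t`. -/
def lipConst (t : ℕ) : ℝ := ∑ m, P.p t m * (P.lLam t m + P.lRho t m)

/-! ### The regularized problem -/

/-- Regularized expected cost-to-go function of stage `t`, when `k` stages follow it: the expectation
of the regularized value functions `Q_m^R` of the children, each the optimal value of a
regularized nodal problem. -/
def regCostToGoAux : ∀ (_k t : ℕ), E t → ℝ≥0∞
  | 0, _, _ => 0
  | k + 1, t, x => ∑ m, ENNReal.ofReal (P.p t m) *
      ⨅ u ∈ P.F t m, ⨅ z ∈ P.X t,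
        (P.f t m z u.2 u.1 + ENNReal.ofReal (P.σ t m * P.ψ t m (x - z)) +
          regCostToGoAux k (t + 1) u.1)

/-- Regularized expected cost-to-go function of stage `t ≤ T`. -/
def regCostToGo (t : ℕ) : E t → ℝ≥0∞ := P.regCostToGoAux (P.T - t) t

/-- Optimal value of the regularized root problem. -/
def vReg : ℝ≥0∞ := ⨅ u ∈ P.F₀, (P.f₀ u.2 u.1 + P.regCostToGo 0 u.1)

/-- `u = (x, y)` is an `η`-optimal root node solution of the regularized problem. -/
def IsOptimalRoot (η : ℝ) (u : E 0 × Yr) : Prop :=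
  u ∈ P.F₀ ∧ P.f₀ u.2 u.1 + P.regCostToGo 0 u.1 ≤ P.vReg + ENNReal.ofReal η

/-! ### Subproblem oracles -/

/-- Objective of the root subproblem with under-approximation `Θ` of the cost-to-go function. -/
def rootObj (Θ : E 0 → ℝ) (u : E 0 × Yr) : EReal :=
  (P.f₀ u.2 u.1 : EReal) + (Θ u.1 : EReal)

/-- Objective of the forward subproblem of node `m` at parent state `xa`. -/
def fwdObj (t : ℕ) (m : N t) (xa : E t) (Θ : E (t + 1) → ℝ)
    (x : E (t + 1)) (y : Y t m) (z : E t) : EReal :=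
  (P.f t m z y x : EReal) + ((P.σ t m * P.ψ t m (xa - z) + Θ x : ℝ) : EReal)

/-- Inner objective of the backward subproblem of node `m` at parent state `xa`. -/
def bwdObj (t : ℕ) (m : N t) (xa : E t) (Θ : E (t + 1) → ℝ) (lam : StrongDual ℝ (E t)) (rho : ℝ)
    (x : E (t + 1)) (y : Y t m) (z : E t) : EReal :=
  (P.f t m z y x : EReal) + ((lam (xa - z) + rho * P.ψ t m (xa - z) + Θ x : ℝ) : EReal)

/-- Inner minimum of the backward subproblem. -/
def bwdVal (t : ℕ) (m : N t) (xa : E t) (Θ : E (t + 1) → ℝ) (lam : StrongDual ℝ (E t))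
    (rho : ℝ) : EReal :=
  ⨅ u ∈ P.F t m, ⨅ z ∈ P.X t, P.bwdObj t m xa Θ lam rho u.1 u.2 z

/-- The set of dual variables `(λ, ρ)` of node `m`; the norm of `λ` is the dual norm. -/
def dualSet (t : ℕ) (m : N t) : Set (StrongDual ℝ (E t) × ℝ) :=
  {v | ‖v.1‖ ≤ P.lLam t m ∧ 0 ≤ v.2 ∧ v.2 ≤ P.lRho t m}

/-- Output `(x, y, z)` of a forward oracle. -/
structure FwdSol (P : StagewiseProgram E N Yr Y) (t : ℕ) (m : N t) where
  x : E (t + 1)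
  y : Y t m
  z : E t

/-- Output `(x, y, z; λ, ρ)` of a backward oracle. -/
structure BwdSol (P : StagewiseProgram E N Yr Y) (t : ℕ) (m : N t) where
  x : E (t + 1)
  y : Y t m
  z : E t
  lam : StrongDual ℝ (E t)
  rho : ℝ

/-- Subproblem oracles: mappings that return some optimal solution of the subproblem, for every
feasible parent state and every function `Θ` that is lower semicontinuous on the state space of
the node (the projection of its feasibility set). -/
structure Oracles (P : StagewiseProgram E N Yr Y) where
  root : (E 0 → ℝ) → E 0 × Yr
  fwd : ∀ t m, E t → (E (t + 1) → ℝ) → P.FwdSol t m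
  bwd : ∀ t m, E t → (E (t + 1) → ℝ) → P.BwdSol t m
  root_spec : ∀ Θ, LowerSemicontinuousOn Θ (P.X 0) →
    root Θ ∈ P.F₀ ∧ ∀ u ∈ P.F₀, P.rootObj Θ (root Θ) ≤ P.rootObj Θ u
  fwd_spec : ∀ t < P.T, ∀ m, ∀ xa ∈ P.X t, ∀ Θ, LowerSemicontinuousOn Θ (Prod.fst '' P.F t m) →
    ((fwd t m xa Θ).x, (fwd t m xa Θ).y) ∈ P.F t m ∧ (fwd t m xa Θ).z ∈ P.X t ∧
    ∀ u ∈ P.F t m, ∀ z ∈ P.X t,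
      P.fwdObj t m xa Θ (fwd t m xa Θ).x (fwd t m xa Θ).y (fwd t m xa Θ).z ≤
        P.fwdObj t m xa Θ u.1 u.2 z
  bwd_spec : ∀ t < P.T, ∀ m, ∀ xa ∈ P.X t, ∀ Θ, LowerSemicontinuousOn Θ (Prod.fst '' P.F t m) →
    ((bwd t m xa Θ).x, (bwd t m xa Θ).y) ∈ P.F t m ∧ (bwd t m xa Θ).z ∈ P.X t ∧
    ((bwd t m xa Θ).lam, (bwd t m xa Θ).rho) ∈ P.dualSet t m ∧
    P.bwdObj t m xa Θ (bwd t m xa Θ).lam (bwd t m xa Θ).rho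
        (bwd t m xa Θ).x (bwd t m xa Θ).y (bwd t m xa Θ).z =
      P.bwdVal t m xa Θ (bwd t m xa Θ).lam (bwd t m xa Θ).rho ∧
    ∀ v ∈ P.dualSet t m,
      P.bwdVal t m xa Θ v.1 v.2 ≤ P.bwdVal t m xa Θ (bwd t m xa Θ).lam (bwd t m xa Θ).rho

/-- An arbitrary rule (possibly changing with the iteration `i`) that selects, in stage `t + 1`,
a node with the largest approximation gap.  (The index sets `N t` with `t ≥ T` play no role; they are
any nonempty finite sets.) -/
structure SelectionRule (N : ℕ → Type*) where
  sel : ℕ → ∀ t, (N t → EReal) → N t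
  sel_max : ∀ (i t : ℕ) (γ : N t → EReal) (m : N t), γ m ≤ γ (sel i t γ)

/-! ### Deterministic sampling dual dynamic programming -/

/-- Biconjugate `x ↦ sup_λ inf_z (g z + ⟨λ, x - z⟩)`. -/
def _root_.biconjugate {V : Type*} [NormedAddCommGroup V] [NormedSpace ℝ V] (g : V → EReal) :
    V → EReal :=
  fun x => ⨆ lam : StrongDual ℝ V, ⨅ z : V, (g z + ((lam (x - z) : ℝ) : EReal))

/-- The state of the algorithm after `i` iterations: under- and over-approximations of the
cost-to-go function of every stage, the root solution `(x₀^{i+1}, y₀^{i+1})`, the two bounds, and the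
incumbent root solution. -/
structure AlgState (P : StagewiseProgram E N Yr Y) where
  lowQ : ∀ t, E t → ℝ
  upQ : ∀ t, E t → EReal
  root : E 0 × Yr
  lower : EReal
  upper : EReal
  best : E 0 × Yr

variable {P}

/-- Initialization.  The incumbent is not yet meaningful. -/
def Oracles.init (O : P.Oracles) : P.AlgState where
  lowQ := fun _ _ => 0
  upQ := fun t _ => if t < P.T then ⊤ else 0
  root := O.root (fun _ => 0)
  lower := (P.f₀ (O.root (fun _ => 0)).2 (O.root (fun _ => 0)).1 : EReal)
  upper := ⊤
  best := O.root (fun _ => 0)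

/-- Forward step: the states `x_t^i`.  All nodes of stage `t + 1` are solved at `x_t^i`,
and the state of a node with the largest approximation gap becomes the state of stage `t + 1`. -/
def Oracles.forwardState (O : P.Oracles) (S : SelectionRule N) (i : ℕ) (s : P.AlgState) :
    ∀ t, E t
  | 0 => s.root.1
  | t + 1 =>
    let sol := fun m => O.fwd t m (O.forwardState S i s t) (s.lowQ (t + 1))
    let γ : N t → EReal := fun m =>
      s.upQ (t + 1) (sol m).x - (s.lowQ (t + 1) (sol m).x : EReal)
    (sol (S.sel i t γ)).x

/-- Updated under-approximation of stage `t`, when `k` stages follow it, for trial states `xs`.  `v`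
is the lower value of the node `m`, and the summands are the generalized conjugacy cuts.
(`toReal` only changes the type: the cost at the backward solution is finite.) -/
def Oracles.newUnder (O : P.Oracles) (s : P.AlgState) (xs : ∀ t, E t) :
    ∀ (_k t : ℕ), E t → ℝ
  | 0, _ => fun _ => 0
  | k + 1, t =>
    let Θ := O.newUnder s xs k (t + 1)
    let b := fun m => O.bwd t m (xs t) Θ
    let v : N t → ℝ := fun m =>
      (P.f t m (b m).z (b m).y (b m).x).toReal + (b m).lam (xs t - (b m).z) +
        (b m).rho * P.ψ t m (xs t - (b m).z) + Θ (b m).x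
    fun x => max (s.lowQ t x)
      (∑ m, P.p t m *
        (-(b m).lam (xs t - x) - (b m).rho * P.ψ t m (xs t - x) + v m))

open Classical in
/-- Updated over-approximation of stage `t`, when `k` stages follow it.  `v` is the upper value of
the node `m`, computed from its forward solution. -/
def Oracles.newOver (O : P.Oracles) (s : P.AlgState) (xs : ∀ t, E t) :
    ∀ (_k t : ℕ), E t → EReal
  | 0, _ => fun _ => 0
  | k + 1, t =>
    let Ψ := O.newOver s xs k (t + 1)
    let b := fun m => O.fwd t m (xs t) (s.lowQ (t + 1))
    let v : N t → EReal := fun m =>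
      (P.f t m (b m).z (b m).y (b m).x : EReal) +
        ((P.σ t m * P.ψ t m (xs t - (b m).z) : ℝ) : EReal) + Ψ (b m).x
    let g : E t → EReal := fun x => min (s.upQ t x)
      (∑ m, (P.p t m : EReal) * (v m + ((P.σ t m * ‖x - xs t‖ : ℝ) : EReal)))
    if P.IsConvex then biconjugate g else g

open Classical in
/-- One iteration of the algorithm: forward step, backward step, root node update. -/
def Oracles.step (O : P.Oracles) (S : SelectionRule N) (i : ℕ) (s : P.AlgState) : P.AlgState :=
  let xs := O.forwardState S i s
  let lowQ := fun t => O.newUnder s xs (P.T - t) t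
  let upQ := fun t => O.newOver s xs (P.T - t) t
  let r := O.root (lowQ 0)
  let ub : EReal := (P.f₀ r.2 r.1 : EReal) + upQ 0 r.1
  { lowQ := lowQ
    upQ := upQ
    root := r
    lower := (P.f₀ r.2 r.1 : EReal) + (lowQ 0 r.1 : EReal)
    upper := if ub < s.upper then ub else s.upper
    best := if ub < s.upper then r else s.best }

/-- The state of the algorithm after `i` iterations. -/
def Oracles.run (O : P.Oracles) (S : SelectionRule N) : ℕ → P.AlgState
  | 0 => O.init
  | i + 1 => O.step S i (O.run S i)

/-- Run with tolerance `tol`, the algorithm terminates after exactly `i` iterations: the condition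
`UpperBound - LowerBound > tol` of its loop holds before each of them, but not after the last. -/
def Oracles.TerminatesAfter (O : P.Oracles) (S : SelectionRule N) (tol : ℝ) (i : ℕ) : Prop :=
  (∀ j < i, (tol : EReal) < (O.run S j).upper - (O.run S j).lower) ∧
    (O.run S i).upper - (O.run S i).lower ≤ (tol : EReal)

end StagewiseProgram

end Program

end

set_option linter.unusedSectionVars false

/-! The two families of approximations bracket different functions. Setting the copy `z` equal to
the parent state removes penalty and multiplier terms, so every cut lies below the original
cost-to-go function, however large the multipliers are (`Oracles.cut_le`,
`Oracles.validLow_newUnder`). The over-approximations lie above the regularized cost-to-go function,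
since forward solutions are feasible for its nodal problems (`Oracles.validUp_newOver`). Exactness
of the penalty closes the circle: some root decision has original value at most `vReg`
(`ExactPenalty.exists_root_le_vReg`), so LB is at most `vReg`, while UB dominates the regularized
value of the incumbent. A gap of at most `T ε` therefore certifies the incumbent.

To count iterations, let the gap of a stage be over- minus under-approximation at its trial state.
The backward subproblem is at least as large as the forward one, because the dual set contains
either `(0, σ)` or a subgradient of norm at most `σ` (`Oracles.fwdValue_le_bwdValue`). Hence, if the
gap of stage `t + 1` at its trial state is at most `δ` before an iteration, then afterwards the gap
of stage `t` at any state `x` is at most `δ + 2 L ‖x - x_t‖` (`AlgState.Valid.gapLe_step`). Gaps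
never grow later.

Now compare the gap of stage `t` with `(T - t) ε`. It is larger at `t = 0` as long as the algorithm
runs, and not larger at `t = T`, where it is zero. So in every iteration some stage `t` exceeds its
threshold while stage `t + 1` does not (`AlgState.Valid.exists_stage`). That iteration pushes the
gap of stage `t` below its threshold on the open ball of radius `ε / (2 L)` around the trial state,
for good. Iterations charged to the same stage thus have trial states at mutual distance at least `ε
/ (2 L)`, and a volume argument allows at most `(1 + 2 L D / ε) ^ d` of them. Summing over the `T`
stages gives the bound. -/

noncomputable section

/-! ### Packing in balls, and subgradients of Lipschitz infimal convolutions. -/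

section ConvexAnalysis

open MeasureTheory Metric in
/-- A finite `δ`-separated subset of a ball of radius `R` in a `d`-dimensional normed space has at
most `(1 + 2 R / δ) ^ d` points. -/
theorem Finset.card_le_of_pairwise_separated {V : Type*} [NormedAddCommGroup V] [NormedSpace ℝ V]
    [FiniteDimensional ℝ V] (s : Finset V) (c : V) {R δ : ℝ} (hR : 0 ≤ R) (hδ : 0 < δ)
    (hs : ∀ x ∈ s, x ∈ closedBall c R) (h : ∀ x ∈ s, ∀ y ∈ s, x ≠ y → δ ≤ ‖x - y‖) :
    (s.card : ℝ) ≤ (1 + 2 * R / δ) ^ Module.finrank ℝ V := by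
  borelize V
  let μ : Measure V := Measure.addHaar
  have hδ2 : 0 < δ / 2 := half_pos hδ
  have hρ : 0 < δ / 2 + R := by positivity
  set A := ⋃ x ∈ s, ball (x : V) (δ / 2) with hA
  have hdisj : Set.Pairwise (s : Set V) (Function.onFun Disjoint fun x => ball (x : V) (δ / 2)) := by
    intro x hx y hy hxy
    apply ball_disjoint_ball
    rw [dist_eq_norm]
    linarith [h x hx y hy hxy]
  have hsub : A ⊆ ball c (δ / 2 + R) := by
    refine iUnion₂_subset fun x hx => ball_subset_ball' ?_
    have := hs x hx
    rw [mem_closedBall] at this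
    linarith
  have hvol : (s.card : ℝ≥0∞) * ENNReal.ofReal ((δ / 2) ^ Module.finrank ℝ V) * μ (ball 0 1) ≤
      ENNReal.ofReal ((δ / 2 + R) ^ Module.finrank ℝ V) * μ (ball 0 1) :=
    calc
      _ = μ A := by
        rw [hA, measure_biUnion_finset hdisj fun c _ => measurableSet_ball]
        simp only [μ.addHaar_ball_of_pos _ hδ2, Finset.sum_const, nsmul_eq_mul, mul_assoc]
      _ ≤ μ (ball c (δ / 2 + R)) := measure_mono hsub
      _ = _ := by simp only [μ.addHaar_ball_of_pos _ hρ]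
  have hcard := (ENNReal.mul_le_mul_iff_left (measure_ball_pos _ _ zero_lt_one).ne'
    measure_ball_lt_top.ne).1 hvol
  have hreal := ENNReal.toReal_le_of_le_ofReal (pow_nonneg hρ.le _) hcard
  rw [ENNReal.toReal_mul, ENNReal.toReal_natCast,
    ENNReal.toReal_ofReal (pow_nonneg hδ2.le _)] at hreal
  have hratio : 1 + 2 * R / δ = (δ / 2 + R) / (δ / 2) := by field_simp
  rw [hratio, div_pow, le_div_iff₀ (pow_pos hδ2 _)]
  exact hreal

variable {V : Type*} [NormedAddCommGroup V] [NormedSpace ℝ V]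

/-- A convex `K`-Lipschitz function has a subgradient of norm at most `K` at every point. -/
theorem ConvexOn.exists_subgradient {h : V → ℝ} {K : ℝ} (hK : 0 ≤ K) (hc : ConvexOn ℝ univ h)
    (hLip : ∀ x y, h x ≤ h y + K * ‖x - y‖) (x : V) :
    ∃ lam : StrongDual ℝ V, ‖lam‖ ≤ K ∧ ∀ z, h x + lam (z - x) ≤ h z := by
  have hcont : Continuous h := by
    refine (LipschitzWith.of_dist_le_mul (K := K.toNNReal) fun x y => ?_).continuous
    rw [Real.dist_eq, dist_eq_norm, Real.coe_toNNReal _ hK, abs_le]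
    have h1 := hLip x y
    have h2 := hLip y x
    rw [norm_sub_rev] at h2
    constructor <;> linarith
  have hopen : IsOpen {q : V × ℝ | h q.1 < q.2} :=
    isOpen_lt (hcont.comp continuous_fst) continuous_snd
  have hconv : Convex ℝ {q : V × ℝ | h q.1 < q.2} := by
    have := hc.convex_strict_epigraph
    simpa using this
  obtain ⟨g, hg⟩ := geometric_hahn_banach_open_point (x := (x, h x)) hconv hopen (by simp)
  have hsplit : ∀ (z : V) (r : ℝ), g (z, r) = g (z, 0) + r * g (0, 1) := by
    intro z r
    rw [← smul_eq_mul, ← map_smul, ← map_add]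
    simp
  -- The strict epigraph contains a point vertically above `(x, h x)`, so the separating hyperplane
  -- is not vertical and can be normalized to a slope.
  have hneg : g (0, 1) < 0 := by
    have := hg (x, h x + 1) (by simp)
    rw [hsplit, hsplit x (h x)] at this
    linarith
  set b := -g (0, 1) with hb
  have hbpos : 0 < b := by simp [hb, hneg]
  let lam : StrongDual ℝ V := b⁻¹ • g.comp (ContinuousLinearMap.inl ℝ V ℝ)
  have hlam : ∀ z, lam z = b⁻¹ * g (z, 0) := fun z => by simp [lam]
  have hsub : ∀ z, h x + lam (z - x) ≤ h z := by
    intro z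
    refine le_of_forall_pos_lt_add fun e he => ?_
    have := hg (z, h z + e) (by simpa using he)
    rw [hsplit, hsplit x (h x)] at this
    rw [map_sub, hlam, hlam, ← mul_sub]
    have h3 : g (z, 0) - g (x, 0) < b * (h z + e - h x) := by rw [hb]; linarith
    have h4 : b⁻¹ * (g (z, 0) - g (x, 0)) < h z + e - h x := by
      rw [inv_mul_lt_iff₀ hbpos]; exact h3
    linarith
  refine ⟨lam, lam.opNorm_le_bound hK fun v => ?_, hsub⟩
  -- The subgradient inequality at `x + v` and at `x - v`, with the Lipschitz bound, gives the two
  -- sides.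
  rw [Real.norm_eq_abs, abs_le]
  have h1 := hsub (x + v)
  have h2 := hsub (x - v)
  have h3 := hLip (x + v) x
  have h4 := hLip (x - v) x
  simp at h1 h2 h3 h4
  constructor <;> linarith

theorem ConvexOn.ofReal_comp {W : Type*} [AddCommGroup W] [Module ℝ W] {S : Set W} {g : W → ℝ}
    (hg : ConvexOn ℝ S g) (h0 : ∀ x ∈ S, 0 ≤ g x) :
    ConvexOn ℝ≥0 S fun x => ENNReal.ofReal (g x) := by
  refine ⟨fun x hx y hy a b _ _ hab => ?_, fun x hx y hy a b _ _ hab => ?_⟩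
  · exact hg.1 hx hy a.coe_nonneg b.coe_nonneg (by exact_mod_cast hab)
  · have := hg.2 hx hy a.coe_nonneg b.coe_nonneg (by exact_mod_cast hab)
    calc ENNReal.ofReal (g (a • x + b • y)) ≤ ENNReal.ofReal (a * g x + b * g y) :=
          ENNReal.ofReal_le_ofReal this
      _ = a • ENNReal.ofReal (g x) + b • ENNReal.ofReal (g y) := by
          rw [ENNReal.ofReal_add (mul_nonneg a.coe_nonneg (h0 x hx))
            (mul_nonneg b.coe_nonneg (h0 y hy)),
            ENNReal.ofReal_mul a.coe_nonneg, ENNReal.ofReal_mul b.coe_nonneg, ENNReal.ofReal_coe_nnreal,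
            ENNReal.ofReal_coe_nnreal]
          rfl

/-- Partial minimization of a jointly convex function is convex. -/
theorem ConvexOn.iInf_right {W Z : Type*} [AddCommGroup W] [Module ℝ W] [AddCommGroup Z]
    [Module ℝ Z] {C : Set W} {S : Set Z} {Φ : W × Z → ℝ≥0∞} (hC : Convex ℝ C)
    (hΦ : ConvexOn ℝ≥0 (C ×ˢ S) Φ) : ConvexOn ℝ≥0 C fun w => ⨅ s ∈ S, Φ (w, s) := by
  refine ⟨fun x hx y hy a b _ _ hab => hC hx hy a.coe_nonneg b.coe_nonneg (by exact_mod_cast hab),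
    fun x hx y hy a b ha hb hab => ?_⟩
  -- Zero weights are treated apart: the lemma that moves a factor inside an infimum in `ℝ≥0∞` needs
  -- it nonzero, as `0 * ⊤ = 0`.
  rcases eq_or_ne a 0 with rfl | ha0
  · obtain rfl : b = 1 := by simpa using hab
    simp
  rcases eq_or_ne b 0 with rfl | hb0
  · obtain rfl : a = 1 := by simpa using hab
    simp
  change _ ≤ (a : ℝ≥0∞) * _ + (b : ℝ≥0∞) * _
  simp only [iInf_subtype']
  rw [ENNReal.mul_iInf_of_ne (by simpa using ha0) (by simp),
    ENNReal.mul_iInf_of_ne (by simpa using hb0) (by simp), ENNReal.iInf_add]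
  refine le_iInf fun s => ?_
  rw [ENNReal.add_iInf]
  refine le_iInf fun s' => ?_
  have hs : a • (x, (s : Z)) + b • (y, (s' : Z)) ∈ C ×ˢ S :=
    hΦ.1 (mk_mem_prod hx s.2) (mk_mem_prod hy s'.2) ha hb hab
  exact (iInf_le _ (⟨_, hs.2⟩ : S)).trans
    (hΦ.2 (mk_mem_prod hx s.2) (mk_mem_prod hy s'.2) ha hb hab)

/-- Infimal convolution of `φ` on `S` with `K * ‖·‖`, along a map `π`. -/
def infConvNorm {V W : Type*} [NormedAddCommGroup V] (S : Set W) (φ : W → ℝ≥0∞) (π : W → V) (K : ℝ) (w : V) : ℝ≥0∞ :=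
  ⨅ s ∈ S, (φ s + ENNReal.ofReal (K * ‖w - π s‖))

theorem infConvNorm_lt_top {V W : Type*} [NormedAddCommGroup V] {S : Set W} {φ : W → ℝ≥0∞} {π : W → V} {K : ℝ}
    (hfin : ∃ s ∈ S, φ s < ⊤) (w : V) : infConvNorm S φ π K w < ⊤ := by
  obtain ⟨s, hs, hφ⟩ := hfin
  exact (iInf₂_le s hs).trans_lt (ENNReal.add_lt_top.2 ⟨hφ, ENNReal.ofReal_lt_top⟩)

/-- Triangle inequality inside the infimum; neither convexity nor finiteness of `φ` matters. -/
theorem infConvNorm_le_add {V W : Type*} [NormedAddCommGroup V] {S : Set W} {φ : W → ℝ≥0∞} {π : W → V} {K : ℝ}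
    (hK : 0 ≤ K) (w w' : V) :
    infConvNorm S φ π K w ≤ infConvNorm S φ π K w' + ENNReal.ofReal (K * ‖w - w'‖) := by
  unfold infConvNorm
  rw [← tsub_le_iff_right]
  refine le_iInf₂ fun s hs => ?_
  rw [tsub_le_iff_right, add_assoc, ← ENNReal.ofReal_add (by positivity) (by positivity)]
  refine (iInf₂_le s hs).trans (add_le_add le_rfl (ENNReal.ofReal_le_ofReal ?_))
  rw [← mul_add, add_comm]
  exact mul_le_mul_of_nonneg_left (norm_sub_le_norm_sub_add_norm_sub _ _ _) hK

theorem infConvNorm_toReal_le_add {V W : Type*} [NormedAddCommGroup V] {S : Set W} {φ : W → ℝ≥0∞} {π : W → V} {K : ℝ}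
    (hK : 0 ≤ K) (hfin : ∃ s ∈ S, φ s < ⊤) (w w' : V) :
    (infConvNorm S φ π K w).toReal ≤ (infConvNorm S φ π K w').toReal + K * ‖w - w'‖ := by
  have h := infConvNorm_le_add (S := S) (φ := φ) (π := π) hK w w'
  have h' := ENNReal.toReal_mono
    (ENNReal.add_ne_top.2 ⟨(infConvNorm_lt_top hfin w').ne, ENNReal.ofReal_ne_top⟩) h
  rwa [ENNReal.toReal_add (infConvNorm_lt_top hfin w').ne ENNReal.ofReal_ne_top,
    ENNReal.toReal_ofReal (by positivity)] at h'

theorem ConvexOn.toReal_comp {W : Type*} [AddCommGroup W] [Module ℝ W] {S : Set W} {g : W → ℝ≥0∞}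
    (hS : Convex ℝ S) (hg : ConvexOn ℝ≥0 S g) (hfin : ∀ x ∈ S, g x < ⊤) :
    ConvexOn ℝ S fun x => (g x).toReal := by
  refine ⟨hS, fun x hx y hy a b ha hb hab => ?_⟩
  lift a to ℝ≥0 using ha
  lift b to ℝ≥0 using hb
  have h : g (a • x + b • y) ≤ (a : ℝ≥0∞) * g x + (b : ℝ≥0∞) * g y :=
    hg.2 hx hy zero_le zero_le (by exact_mod_cast hab)
  have hx' : (a : ℝ≥0∞) * g x ≠ ⊤ := ENNReal.mul_ne_top ENNReal.coe_ne_top (hfin x hx).ne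
  have hy' : (b : ℝ≥0∞) * g y ≠ ⊤ := ENNReal.mul_ne_top ENNReal.coe_ne_top (hfin y hy).ne
  have h' := ENNReal.toReal_mono (ENNReal.add_ne_top.2 ⟨hx', hy'⟩) h
  rw [ENNReal.toReal_add hx' hy', ENNReal.toReal_mul, ENNReal.toReal_mul] at h'
  exact h'

/-- Linearity of `π` makes the minimized expression jointly convex in `(w, s)`, and partial
minimization over `s` preserves convexity. -/
theorem convexOn_infConvNorm {W : Type*} [AddCommGroup W] [Module ℝ W] {S : Set W}
    {φ : W → ℝ≥0∞} (π : W →ₗ[ℝ] V) {K : ℝ} (hK : 0 ≤ K) (hφ : ConvexOn ℝ≥0 S φ) :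
    ConvexOn ℝ≥0 univ (infConvNorm S φ π K) := by
  have hS : Convex ℝ≥0 (univ ×ˢ S : Set (V × W)) := convex_univ.prod hφ.1
  have hSR : Convex ℝ (univ ×ˢ S : Set (V × W)) := fun x hx y hy a b ha hb hab =>
    hS hx hy (a := ⟨a, ha⟩) (b := ⟨b, hb⟩) zero_le zero_le (NNReal.eq hab)
  have h1 : ConvexOn ℝ≥0 (univ ×ˢ S : Set (V × W)) fun q => φ q.2 :=
    ⟨hS, fun x hx y hy a b ha hb hab => hφ.2 hx.2 hy.2 ha hb hab⟩
  have h2 : ConvexOn ℝ (univ ×ˢ S : Set (V × W)) fun q => K * ‖q.1 - π q.2‖ := by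
    refine ⟨hSR, fun x hx y hy a b ha hb hab => ?_⟩
    have : (a • x + b • y).1 - π (a • x + b • y).2 = a • (x.1 - π x.2) + b • (y.1 - π y.2) := by
      simp only [Prod.fst_add, Prod.snd_add, Prod.smul_fst, Prod.smul_snd, map_add, map_smul,
        smul_sub]
      abel
    simp only [this, smul_eq_mul]
    have h := norm_add_le (a • (x.1 - π x.2)) (b • (y.1 - π y.2))
    rw [norm_smul, norm_smul, Real.norm_of_nonneg ha, Real.norm_of_nonneg hb] at h
    linarith [mul_le_mul_of_nonneg_left h hK]
  have h3 : ConvexOn ℝ≥0 (univ ×ˢ S : Set (V × W)) fun q => ENNReal.ofReal (K * ‖q.1 - π q.2‖) :=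
    h2.ofReal_comp fun q _ => mul_nonneg hK (norm_nonneg _)
  have h4 : ConvexOn ℝ≥0 (univ ×ˢ S : Set (V × W))
      fun q => φ q.2 + ENNReal.ofReal (K * ‖q.1 - π q.2‖) := by
    refine ⟨hS, fun x hx y hy a b ha hb hab => (add_le_add (h1.2 hx hy ha hb hab)
      (h3.2 hx hy ha hb hab)).trans_eq ?_⟩
    rw [smul_add, smul_add, add_add_add_comm]
  exact ConvexOn.iInf_right (Φ := fun q : V × W => φ q.2 + ENNReal.ofReal (K * ‖q.1 - π q.2‖))
    convex_univ h4

/-- Subgradients of an infimal convolution of a convex function with `K * ‖·‖`. -/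
theorem exists_subgradient_infConvNorm {W : Type*} [AddCommGroup W] [Module ℝ W] {S : Set W}
    {φ : W → ℝ≥0∞} (π : W →ₗ[ℝ] V) {K : ℝ} (hK : 0 ≤ K) (hφ : ConvexOn ℝ≥0 S φ)
    (hfin : ∃ s ∈ S, φ s < ⊤) (x : V) :
    ∃ lam : StrongDual ℝ V, ‖lam‖ ≤ K ∧ ∀ z,
      (infConvNorm S φ π K x).toReal + lam (z - x) ≤ (infConvNorm S φ π K z).toReal :=
  (ConvexOn.toReal_comp convex_univ (convexOn_infConvNorm π hK hφ)
    fun x _ => infConvNorm_lt_top hfin x).exists_subgradient hK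
    (fun x y => infConvNorm_toReal_le_add hK hfin x y) x

theorem infConvNorm_le_self {V W : Type*} [NormedAddCommGroup V] {S : Set W} {φ : W → ℝ≥0∞} {π : W → V} {K : ℝ} {s : W}
    (hs : s ∈ S) : infConvNorm S φ π K (π s) ≤ φ s :=
  (iInf₂_le s hs).trans (by simp)

end ConvexAnalysis

namespace StagewiseProgram

variable {E : ℕ → Type*} [∀ t, NormedAddCommGroup (E t)] [∀ t, NormedSpace ℝ (E t)]
  {N : ℕ → Type*} [∀ t, Fintype (N t)]
  {Yr : Type*} [NormedAddCommGroup Yr] [NormedSpace ℝ Yr]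
  {Y : ∀ t, N t → Type*} [∀ t m, NormedAddCommGroup (Y t m)] [∀ t m, NormedSpace ℝ (Y t m)]
  {P : StagewiseProgram E N Yr Y}

/-! ### Elementary properties of the program -/

/-- Descending induction whose base covers all stages from the horizon on, so that invariants can be
stated for every `t`. -/
theorem stage_induction {motive : ℕ → Prop} (T : ℕ) (base : ∀ t, T ≤ t → motive t)
    (step : ∀ t < T, motive (t + 1) → motive t) (t : ℕ) : motive t := by
  obtain h | h := le_total T t
  · exact base t h
  · induction h using Nat.decreasingInduction with
    | of_succ k hk ih => exact step k hk ih
    | self => exact base T le_rfl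

theorem state_mem {t : ℕ} (ht : t + 1 < P.T) {m : N t} {u : E (t + 1) × Y t m}
    (hu : u ∈ P.F t m) : u.1 ∈ P.X (t + 1) := by
  rw [P.X_succ t ht m]
  exact mem_image_of_mem _ hu

theorem nonempty_children {t : ℕ} (ht : t < P.T) : Nonempty (N t) := by
  by_contra h
  rw [not_nonempty_iff] at h
  have := P.p_sum t ht
  simp at this

theorem prob_pos : ∀ (t : ℕ) (_ : t ≤ P.T) (w : ScenarioNode N t), 0 < P.prob t w
  | 0, _, _ => one_pos
  | t + 1, ht, w => mul_pos (prob_pos t (by omega) w.1) (P.p_pos t (by omega) w.2)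

theorem nonempty_scenarioNode : ∀ (t : ℕ) (_ : t ≤ P.T), Nonempty (ScenarioNode N t)
  | 0, _ => ⟨PUnit.unit⟩
  | t + 1, ht => by
    obtain ⟨w⟩ := nonempty_scenarioNode t (by omega)
    obtain ⟨m⟩ := P.nonempty_children (t := t) (by omega)
    exact ⟨(w, m)⟩

theorem Decision.Feasible.x_mem {u : P.Decision} (hu : u.Feasible) :
    ∀ (t : ℕ) (_ : t < P.T) (w : ScenarioNode N t), u.x t w ∈ P.X t
  | 0, _, w => by
    rw [P.X_zero]
    exact mem_image_of_mem _ hu.1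
  | t + 1, ht, w => P.state_mem ht (hu.2 t (by omega) w.1 w.2).1

theorem MinCondition.isCompact_X (hmin : P.MinCondition) : ∀ t < P.T, IsCompact (P.X t)
  | 0, _ => by
    rw [P.X_zero]
    exact hmin.1.image continuous_fst
  | t + 1, ht => by
    obtain ⟨m⟩ := P.nonempty_children (t := t) (by omega)
    rw [P.X_succ t ht m]
    exact (hmin.2.2.1 t (by omega) m).1.image continuous_fst

theorem MinCondition.exists_root_lt_top (hmin : P.MinCondition) :
    ∃ u ∈ P.F₀, P.f₀ u.2 u.1 < ⊤ := by
  obtain ⟨u, hu, hfin⟩ := hmin.2.2.2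
  exact ⟨_, hu.1, (ENNReal.add_lt_top.1 hfin).1⟩

theorem MinCondition.exists_lt_top (hmin : P.MinCondition) {t : ℕ} (ht : t < P.T) (m : N t) :
    ∃ u ∈ P.F t m, ∃ z ∈ P.X t, P.f t m z u.2 u.1 < ⊤ := by
  obtain ⟨u, hu, hfin⟩ := hmin.2.2.2
  obtain ⟨w⟩ := P.nonempty_scenarioNode t ht.le
  have h1 := (ENNReal.add_lt_top.1 hfin).2
  rw [ENNReal.sum_lt_top] at h1
  have h2 := h1 t (Finset.mem_range.2 ht)
  rw [ENNReal.sum_lt_top] at h2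
  have h3 := h2 w (Finset.mem_univ _)
  rw [ENNReal.sum_lt_top] at h3
  have h4 := h3 m (Finset.mem_univ _)
  refine ⟨_, (hu.2 t ht w m).1, _, hu.x_mem t ht w, ?_⟩
  -- Every scenario node has positive probability, so an infinite cost at one node would make the
  -- expected cost infinite.
  have h5 : ENNReal.ofReal (P.prob (t + 1) (w, m)) ≠ 0 := by
    simpa using P.prob_pos (t + 1) ht (w, m)
  exact lt_top_iff_ne_top.2 fun h => by simp [h, ENNReal.mul_top h5] at h4

theorem PenaltyCondition.psi_nonneg (hpen : P.PenaltyCondition) {t : ℕ} (ht : t < P.T) (m : N t)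
    (x : E t) : 0 ≤ P.ψ t m x := (hpen t ht m).1.1 x

theorem PenaltyCondition.psi_zero (hpen : P.PenaltyCondition) {t : ℕ} (ht : t < P.T) (m : N t) :
    P.ψ t m 0 = 0 := ((hpen t ht m).1.2.1 0).2 rfl

theorem PenaltyCondition.psi_sub_le (hpen : P.PenaltyCondition) {t : ℕ} (ht : t < P.T) (m : N t)
    {x x' z : E t} (hx : x ∈ P.X t) (hx' : x' ∈ P.X t) (hz : z ∈ P.X t) :
    P.ψ t m (x - z) ≤ P.ψ t m (x' - z) + ‖x - x'‖ := by
  have h := (hpen t ht m).2.dist_le_mul _ (sub_mem_sub hx hz) _ (sub_mem_sub hx' hz)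
  rw [Real.dist_eq, dist_eq_norm, sub_sub_sub_cancel_right, NNReal.coe_one, one_mul] at h
  linarith [(abs_le.1 h).2]

theorem PenaltyCondition.psi_le_norm (hpen : P.PenaltyCondition) {t : ℕ} (ht : t < P.T) (m : N t)
    {x z : E t} (hx : x ∈ P.X t) (hz : z ∈ P.X t) : P.ψ t m (x - z) ≤ ‖x - z‖ := by
  have h := hpen.psi_sub_le ht m hx hz hz
  rwa [sub_self, hpen.psi_zero ht, zero_add] at h

theorem PenaltyCondition.continuousOn_psi (hpen : P.PenaltyCondition) {t : ℕ} (ht : t < P.T)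
    (m : N t) {x : E t} (hx : x ∈ P.X t) : ContinuousOn (fun z => P.ψ t m (x - z)) (P.X t) :=
  (hpen t ht m).2.continuousOn.comp (by fun_prop) fun _ hz => sub_mem_sub hx hz

/-- Lipschitz constant `∑ m, p_m σ_m` of the regularized cost-to-go function. -/
def penaltyConst (P : StagewiseProgram E N Yr Y) (t : ℕ) : ℝ := ∑ m, P.p t m * P.σ t m

theorem penaltyConst_nonneg {t : ℕ} (ht : t < P.T) : 0 ≤ P.penaltyConst t :=
  Finset.sum_nonneg fun m _ => mul_nonneg (P.p_pos t ht m).le (P.σ_pos t ht m).le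

theorem DualBoundCondition.sigma_le (hdual : P.DualBoundCondition) {t : ℕ} (ht : t < P.T)
    (m : N t) : P.σ t m ≤ P.lLam t m + P.lRho t m := by
  rcases hdual with h | h
  · linarith [(h.2 t ht m).2.1, P.lRho_nonneg t ht m]
  · linarith [h t ht m, P.lLam_nonneg t ht m]

theorem DualBoundCondition.penaltyConst_le (hdual : P.DualBoundCondition) {t : ℕ} (ht : t < P.T) :
    P.penaltyConst t ≤ P.lipConst t :=
  Finset.sum_le_sum fun m _ => mul_le_mul_of_nonneg_left (hdual.sigma_le ht m) (P.p_pos t ht m).le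

theorem penaltyConst_pos {t : ℕ} (ht : t < P.T) : 0 < P.penaltyConst t := by
  obtain ⟨m⟩ := P.nonempty_children ht
  exact Finset.sum_pos (fun m _ => mul_pos (P.p_pos t ht m) (P.σ_pos t ht m)) ⟨m, Finset.mem_univ m⟩

/-! ### Cost-to-go functions -/

theorem regCostToGo_of_le {t : ℕ} (ht : P.T ≤ t) (x : E t) : P.regCostToGo t x = 0 := by
  rw [regCostToGo, Nat.sub_eq_zero_of_le ht, regCostToGoAux]

theorem regCostToGo_of_lt {t : ℕ} (ht : t < P.T) (x : E t) :
    P.regCostToGo t x = ∑ m, ENNReal.ofReal (P.p t m) *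
      ⨅ u ∈ P.F t m, ⨅ z ∈ P.X t,
        (P.f t m z u.2 u.1 + ENNReal.ofReal (P.σ t m * P.ψ t m (x - z)) +
          P.regCostToGo (t + 1) u.1) := by
  rw [regCostToGo, show P.T - t = (P.T - (t + 1)) + 1 by omega, regCostToGoAux]
  rfl

/-- Expected cost-to-go function of stage `t`, when `k` stages follow it. -/
def costToGoAux (P : StagewiseProgram E N Yr Y) : ∀ (_k t : ℕ), E t → ℝ≥0∞
  | 0, _, _ => 0
  | k + 1, t, x => ∑ m, ENNReal.ofReal (P.p t m) *
      ⨅ u ∈ P.F t m, (P.f t m x u.2 u.1 + costToGoAux P k (t + 1) u.1)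

/-- Expected cost-to-go function of the original problem. -/
def costToGo (P : StagewiseProgram E N Yr Y) (t : ℕ) : E t → ℝ≥0∞ := P.costToGoAux (P.T - t) t

theorem costToGo_of_le {t : ℕ} (ht : P.T ≤ t) (x : E t) : P.costToGo t x = 0 := by
  rw [costToGo, Nat.sub_eq_zero_of_le ht, costToGoAux]

theorem costToGo_of_lt {t : ℕ} (ht : t < P.T) (x : E t) :
    P.costToGo t x = ∑ m, ENNReal.ofReal (P.p t m) *
      ⨅ u ∈ P.F t m, (P.f t m x u.2 u.1 + P.costToGo (t + 1) u.1) := by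
  rw [costToGo, show P.T - t = (P.T - (t + 1)) + 1 by omega, costToGoAux]
  rfl

/-- The copy `z` is decoupled from `x`: it can be placed where the nodal cost is finite, at the
price of a finite penalty. -/
theorem MinCondition.regCostToGo_lt_top (hmin : P.MinCondition) (t : ℕ) :
    ∀ x, P.regCostToGo t x < ⊤ := by
  induction t using stage_induction P.T with
  | base t ht => intro x; simp [P.regCostToGo_of_le ht]
  | step t ht ih =>
    intro x
    rw [P.regCostToGo_of_lt ht, ENNReal.sum_lt_top]
    intro m _
    obtain ⟨u, hu, z, hz, hf⟩ := hmin.exists_lt_top ht m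
    refine ENNReal.mul_lt_top ENNReal.ofReal_lt_top ((iInf₂_le u hu).trans_lt
      ((iInf₂_le z hz).trans_lt ?_))
    exact ENNReal.add_lt_top.2 ⟨ENNReal.add_lt_top.2 ⟨hf, ENNReal.ofReal_lt_top⟩, ih _⟩

theorem MinCondition.vReg_lt_top (hmin : P.MinCondition) : P.vReg < ⊤ := by
  obtain ⟨u, hu, hf⟩ := hmin.exists_root_lt_top
  exact (iInf₂_le u hu).trans_lt (ENNReal.add_lt_top.2 ⟨hf, hmin.regCostToGo_lt_top 0 _⟩)

/-- The parent state enters each nodal problem only through the penalty, which is `σ`-Lipschitz on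
differences of states. -/
theorem PenaltyCondition.regCostToGo_le_add (hpen : P.PenaltyCondition) {t : ℕ} (ht : t < P.T)
    {x x' : E t} (hx : x ∈ P.X t) (hx' : x' ∈ P.X t) :
    P.regCostToGo t x ≤ P.regCostToGo t x' + ENNReal.ofReal (P.penaltyConst t * ‖x - x'‖) := by
  have hsum : ENNReal.ofReal (P.penaltyConst t * ‖x - x'‖) =
      ∑ m, ENNReal.ofReal (P.p t m) * ENNReal.ofReal (P.σ t m * ‖x - x'‖) := by
    rw [penaltyConst, Finset.sum_mul, ENNReal.ofReal_sum_of_nonneg]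
    · refine Finset.sum_congr rfl fun m _ => ?_
      rw [mul_assoc, ENNReal.ofReal_mul (P.p_pos t ht m).le]
    · exact fun m _ => mul_nonneg (mul_nonneg (P.p_pos t ht m).le (P.σ_pos t ht m).le)
        (norm_nonneg _)
  rw [P.regCostToGo_of_lt ht, P.regCostToGo_of_lt ht, hsum, ← Finset.sum_add_distrib]
  refine Finset.sum_le_sum fun m _ => ?_
  rw [← mul_add]
  refine mul_le_mul_right ?_ _
  rw [← tsub_le_iff_right]
  refine le_iInf₂ fun u hu => le_iInf₂ fun z hz => ?_
  rw [tsub_le_iff_right]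
  refine (iInf₂_le u hu).trans ((iInf₂_le z hz).trans ?_)
  have hσ := (P.σ_pos t ht m).le
  have key : ENNReal.ofReal (P.σ t m * P.ψ t m (x - z)) ≤
      ENNReal.ofReal (P.σ t m * P.ψ t m (x' - z)) + ENNReal.ofReal (P.σ t m * ‖x - x'‖) := by
    rw [← ENNReal.ofReal_add (mul_nonneg hσ (hpen.psi_nonneg ht m _))
      (mul_nonneg hσ (norm_nonneg _)), ← mul_add]
    exact ENNReal.ofReal_le_ofReal
      (mul_le_mul_of_nonneg_left (hpen.psi_sub_le ht m hx hx' hz) hσ)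
  calc _ ≤ P.f t m z u.2 u.1 + (ENNReal.ofReal (P.σ t m * P.ψ t m (x' - z)) +
        ENNReal.ofReal (P.σ t m * ‖x - x'‖)) + P.regCostToGo (t + 1) u.1 := by gcongr
    _ = _ := by ring

theorem MinCondition.continuousOn_regCostToGo (hmin : P.MinCondition) (hpen : P.PenaltyCondition)
    {t : ℕ} (ht : t < P.T) : ContinuousOn (P.regCostToGo t) (P.X t) := by
  have hfin := hmin.regCostToGo_lt_top t
  have hle : ∀ x ∈ P.X t, ∀ x' ∈ P.X t,
      (P.regCostToGo t x).toReal ≤ (P.regCostToGo t x').toReal + P.penaltyConst t * ‖x - x'‖ := by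
    intro x hx x' hx'
    have h := ENNReal.toReal_mono (ENNReal.add_ne_top.2 ⟨(hfin x').ne, ENNReal.ofReal_ne_top⟩)
      (hpen.regCostToGo_le_add ht hx hx')
    rwa [ENNReal.toReal_add (hfin x').ne ENNReal.ofReal_ne_top, ENNReal.toReal_ofReal
      (mul_nonneg (P.penaltyConst_nonneg ht) (norm_nonneg _))] at h
  have hcont : ContinuousOn (fun x => (P.regCostToGo t x).toReal) (P.X t) := by
    refine (LipschitzOnWith.of_dist_le_mul (K := (P.penaltyConst t).toNNReal)
      fun x hx x' hx' => ?_).continuousOn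
    rw [Real.dist_eq, dist_eq_norm, Real.coe_toNNReal _ (P.penaltyConst_nonneg ht), abs_le]
    have h1 := hle x hx x' hx'
    have h2 := hle x' hx' x hx
    rw [norm_sub_rev] at h2
    constructor <;> linarith
  refine (ENNReal.continuous_ofReal.comp_continuousOn hcont).congr fun x _ => ?_
  simp [ENNReal.ofReal_toReal (hfin x).ne]

theorem MinCondition.lowerSemicontinuousOn_regCostToGo (hmin : P.MinCondition)
    (hpen : P.PenaltyCondition) {t : ℕ} (m : N t) :
    LowerSemicontinuousOn (fun u : E (t + 1) × Y t m => P.regCostToGo (t + 1) u.1) (P.F t m) := by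
  by_cases h : t + 1 < P.T
  · exact ((hmin.continuousOn_regCostToGo hpen h).comp continuous_fst.continuousOn
      fun u hu => P.state_mem h hu).lowerSemicontinuousOn
  · simp only [P.regCostToGo_of_le (not_lt.1 h)]
    exact continuousOn_const.lowerSemicontinuousOn

/-- The regularized nodal problems have optimal solutions. -/
theorem MinCondition.exists_regNode_min (hmin : P.MinCondition) (hpen : P.PenaltyCondition)
    {t : ℕ} (ht : t < P.T) (m : N t) {x : E t} (hx : x ∈ P.X t) :
    ∃ q : (E (t + 1) × Y t m) × E t, q.1 ∈ P.F t m ∧ q.2 ∈ P.X t ∧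
      P.f t m q.2 q.1.2 q.1.1 + ENNReal.ofReal (P.σ t m * P.ψ t m (x - q.2)) +
          P.regCostToGo (t + 1) q.1.1 =
        ⨅ u ∈ P.F t m, ⨅ z ∈ P.X t,
          (P.f t m z u.2 u.1 + ENNReal.ofReal (P.σ t m * P.ψ t m (x - z)) +
            P.regCostToGo (t + 1) u.1) := by
  obtain ⟨hF, hf⟩ := hmin.2.2.1 t ht m
  obtain ⟨u₀, hu₀, z₀, hz₀, -⟩ := hmin.exists_lt_top ht m
  have hψ : ContinuousOn (fun q : E t × (E (t + 1) × Y t m) =>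
      ENNReal.ofReal (P.σ t m * P.ψ t m (x - q.1))) (P.X t ×ˢ P.F t m) :=
    ENNReal.continuous_ofReal.comp_continuousOn (continuousOn_const.mul
      ((hpen.continuousOn_psi ht m hx).comp continuous_fst.continuousOn fun q hq => hq.1))
  have hQ : LowerSemicontinuousOn (fun q : E t × (E (t + 1) × Y t m) =>
      P.regCostToGo (t + 1) q.2.1) (P.X t ×ˢ P.F t m) :=
    (hmin.lowerSemicontinuousOn_regCostToGo hpen m).comp continuous_snd.continuousOn
      fun q hq => hq.2
  obtain ⟨q, hq, hqmin⟩ := ((hf.add hψ.lowerSemicontinuousOn).add hQ).exists_isMinOn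
    (Set.Nonempty.prod ⟨z₀, hz₀⟩ ⟨u₀, hu₀⟩) ((hmin.isCompact_X t ht).prod hF)
  refine ⟨(q.2, q.1), hq.2, hq.1, le_antisymm ?_ ?_⟩
  · exact le_iInf₂ fun u hu => le_iInf₂ fun z hz => hqmin (mk_mem_prod hz hu)
  · exact (iInf₂_le q.2 hq.2).trans (iInf₂_le q.1 hq.1)

theorem MinCondition.exists_regRoot_min (hmin : P.MinCondition) (hpen : P.PenaltyCondition)
    (hT : 1 ≤ P.T) : ∃ u ∈ P.F₀, P.f₀ u.2 u.1 + P.regCostToGo 0 u.1 = P.vReg := by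
  obtain ⟨u₀, hu₀, -⟩ := hmin.exists_root_lt_top
  have hQ : ContinuousOn (fun u : E 0 × Yr => P.regCostToGo 0 u.1) P.F₀ :=
    (hmin.continuousOn_regCostToGo hpen hT).comp continuous_fst.continuousOn
      fun u hu => P.X_zero ▸ mem_image_of_mem _ hu
  obtain ⟨u, hu, humin⟩ := (hmin.2.1.add hQ.lowerSemicontinuousOn).exists_isMinOn
    ⟨u₀, hu₀⟩ hmin.1
  exact ⟨u, hu, le_antisymm (le_iInf₂ fun u' hu' => humin hu') (iInf₂_le u hu)⟩

/-! ### The extensive form -/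

theorem sum_scenarioNode_succ (t : ℕ) (g : ScenarioNode N (t + 1) → ℝ≥0∞) :
    ∑ w, g w = ∑ w : ScenarioNode N t, ∑ m : N t, g (w, m) :=
  Fintype.sum_prod_type g

theorem prob_smul_sum {t : ℕ} (ht : t < P.T) (w : ScenarioNode N t) (g : N t → ℝ≥0∞) :
    ENNReal.ofReal (P.prob t w) * ∑ m, ENNReal.ofReal (P.p t m) * g m =
      ∑ m, ENNReal.ofReal (P.prob (t + 1) (w, m)) * g m := by
  rw [Finset.mul_sum]
  refine Finset.sum_congr rfl fun m _ => ?_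
  rw [← mul_assoc, ← ENNReal.ofReal_mul (P.prob_pos t ht.le w).le]
  rfl

theorem sum_prob_stage (c : ∀ t, ScenarioNode N t → N t → ℝ≥0∞)
    (Φ : ∀ t, ScenarioNode N t → ℝ≥0∞) {t : ℕ} (ht : t < P.T) :
    ∑ w, ENNReal.ofReal (P.prob t w) *
        ∑ m, ENNReal.ofReal (P.p t m) * (c t w m + Φ (t + 1) (w, m)) =
      ∑ w, ∑ m, ENNReal.ofReal (P.prob (t + 1) (w, m)) * c t w m +
        ∑ w, ENNReal.ofReal (P.prob (t + 1) w) * Φ (t + 1) w := by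
  rw [sum_scenarioNode_succ, ← Finset.sum_add_distrib]
  refine Finset.sum_congr rfl fun w _ => ?_
  rw [P.prob_smul_sum ht, ← Finset.sum_add_distrib]
  simp only [mul_add]

/-- A one-step Bellman inequality, weighted by node probabilities, telescopes along the stages. It
is used for both cost-to-go functions. -/
theorem le_sum_stages {c : ∀ t, ScenarioNode N t → N t → ℝ≥0∞}
    {Φ : ∀ t, ScenarioNode N t → ℝ≥0∞}
    (h : ∀ t < P.T, ∀ w, Φ t w ≤ ∑ m, ENNReal.ofReal (P.p t m) * (c t w m + Φ (t + 1) (w, m)))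
    (hT : ∀ w, Φ P.T w = 0) :
    Φ 0 PUnit.unit ≤ ∑ t ∈ Finset.range P.T, ∑ w : ScenarioNode N t, ∑ m : N t,
      ENNReal.ofReal (P.prob (t + 1) (w, m)) * c t w m := by
  have key : ∀ K ≤ P.T, Φ 0 PUnit.unit ≤
      ∑ t ∈ Finset.range K, ∑ w : ScenarioNode N t, ∑ m : N t,
        ENNReal.ofReal (P.prob (t + 1) (w, m)) * c t w m +
      ∑ w, ENNReal.ofReal (P.prob K w) * Φ K w := by
    intro K
    induction K with
    | zero =>
      intro _
      rw [Finset.sum_range_zero, zero_add]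
      refine le_of_eq_of_le ?_ (Finset.single_le_sum (fun _ _ => zero_le)
        (Finset.mem_univ (PUnit.unit : ScenarioNode N 0)))
      simp [prob]
    | succ K ih =>
      intro hK
      refine (ih (by omega)).trans ?_
      rw [Finset.sum_range_succ, add_assoc, ← P.sum_prob_stage c Φ (by omega)]
      gcongr with w
      exact h K (by omega) w
  simpa [hT] using key P.T le_rfl

/-- The reverse telescoping needs no terminal condition, because the remainder is nonnegative and
can be dropped. -/
theorem sum_stages_le {c : ∀ t, ScenarioNode N t → N t → ℝ≥0∞}
    {Φ : ∀ t, ScenarioNode N t → ℝ≥0∞}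
    (h : ∀ t < P.T, ∀ w, ∑ m, ENNReal.ofReal (P.p t m) * (c t w m + Φ (t + 1) (w, m)) ≤ Φ t w) :
    ∑ t ∈ Finset.range P.T, ∑ w : ScenarioNode N t, ∑ m : N t,
      ENNReal.ofReal (P.prob (t + 1) (w, m)) * c t w m ≤ Φ 0 PUnit.unit := by
  have key : ∀ K ≤ P.T,
      ∑ t ∈ Finset.range K, ∑ w : ScenarioNode N t, ∑ m : N t,
        ENNReal.ofReal (P.prob (t + 1) (w, m)) * c t w m +
      ∑ w, ENNReal.ofReal (P.prob K w) * Φ K w ≤ Φ 0 PUnit.unit := by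
    intro K
    induction K with
    | zero =>
      intro _
      rw [Finset.sum_range_zero, zero_add]
      refine (Finset.sum_eq_single (PUnit.unit : ScenarioNode N 0) (fun b _ hb => (hb rfl).elim)
        (fun hb => (hb (Finset.mem_univ _)).elim)).trans_le ?_
      simp [prob]
    | succ K ih =>
      intro hK
      refine le_trans ?_ (ih (by omega))
      rw [Finset.sum_range_succ, add_assoc, ← P.sum_prob_stage c Φ (by omega)]
      gcongr with w
      exact h K (by omega) w
  exact le_self_add.trans (key P.T le_rfl)

theorem vReg_le_penalizedCost {u : P.Decision} (hu : u.Feasible) : P.vReg ≤ u.penalizedCost := by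
  refine (iInf₂_le (_ : E 0 × Yr) hu.1).trans (add_le_add le_rfl ?_)
  refine P.le_sum_stages (Φ := fun t w => P.regCostToGo t (u.x t w)) (fun t ht w => ?_)
    fun w => P.regCostToGo_of_le le_rfl _
  rw [P.regCostToGo_of_lt ht]
  gcongr with m
  exact (iInf₂_le (_ : E (t + 1) × Y t m) (hu.2 t ht w m).1).trans
    (iInf₂_le _ (hu.2 t ht w m).2)

/-- The states of the scenario tree generated from the root state by a policy. -/
def policyState (x₀ : E 0) (pol : ∀ t m, E t → (E (t + 1) × Y t m) × E t) :
    ∀ t, ScenarioNode N t → E t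
  | 0, _ => x₀
  | t + 1, w => (pol t w.2 (policyState x₀ pol t w.1)).1.1

/-- Following a minimizer of the nodal problem at every node of the tree turns the Bellman
inequalities into equalities. Together with `vReg_le_penalizedCost` this produces a minimizer of the
penalty reformulation, to which exactness applies. -/
theorem exists_penalizedCost_le_vReg (hT : 1 ≤ P.T) (hmin : P.MinCondition)
    (hpen : P.PenaltyCondition) :
    ∃ u : P.Decision, u.Feasible ∧ u.penalizedCost ≤ P.vReg := by
  classical
  obtain ⟨u₀, hu₀, hval⟩ := hmin.exists_regRoot_min hpen hT
  choose pol hpolF hpolX hpol using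
    fun (t : ℕ) (ht : t < P.T) (m : N t) (x : E t) (hx : x ∈ P.X t) =>
      hmin.exists_regNode_min hpen ht m hx
  -- Minimizers are chosen only at feasible states; the value `0` elsewhere is never reached, as the
  -- generated states stay in the state spaces.
  let pol' : ∀ t m, E t → (E (t + 1) × Y t m) × E t := fun t m x =>
    if h : t < P.T ∧ x ∈ P.X t then pol t h.1 m x h.2 else 0
  have hpol' : ∀ t (ht : t < P.T) m x (hx : x ∈ P.X t), pol' t m x = pol t ht m x hx :=
    fun t ht m x hx => dif_pos ⟨ht, hx⟩
  let u : P.Decision :=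
    { x := policyState u₀.1 pol'
      y₀ := u₀.2
      y := fun t w m => (pol' t m (policyState u₀.1 pol' t w)).1.2
      z := fun t w m => (pol' t m (policyState u₀.1 pol' t w)).2 }
  have hxF : ∀ t, t < P.T → ∀ w m, u.x t w ∈ P.X t →
      (u.x (t + 1) (w, m), u.y t w m) ∈ P.F t m ∧ u.z t w m ∈ P.X t := by
    intro t ht w m hx
    have h := hpol' t ht m _ hx
    change (pol' t m (u.x t w)).1 ∈ P.F t m ∧ (pol' t m (u.x t w)).2 ∈ P.X t
    rw [h]
    exact ⟨hpolF t ht m _ hx, hpolX t ht m _ hx⟩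
  have hx : ∀ t, t < P.T → ∀ w, u.x t w ∈ P.X t := by
    intro t
    induction t with
    | zero => exact fun _ _ => P.X_zero ▸ mem_image_of_mem _ hu₀
    | succ t ih =>
      exact fun ht w => P.state_mem ht (hxF t (by omega) w.1 w.2 (ih (by omega) w.1)).1
  refine ⟨u, ⟨hu₀, fun t ht w m => hxF t ht w m (hx t ht w)⟩, ?_⟩
  rw [← hval]
  refine add_le_add le_rfl ?_
  refine P.sum_stages_le (Φ := fun t w => P.regCostToGo t (u.x t w)) fun t ht w => ?_
  rw [P.regCostToGo_of_lt ht]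
  gcongr with m
  rw [← hpol t ht m _ (hx t ht w), ← hpol' t ht m _ (hx t ht w)]
  rfl

/-- Under exact penalization, the original problem has an optimal value of at most the regularized
one. -/
theorem ExactPenalty.exists_root_le_vReg (hexact : P.ExactPenalty) (hT : 1 ≤ P.T)
    (hmin : P.MinCondition) (hpen : P.PenaltyCondition) :
    ∃ u ∈ P.F₀, P.f₀ u.2 u.1 + P.costToGo 0 u.1 ≤ P.vReg := by
  obtain ⟨u, hu, hval⟩ := P.exists_penalizedCost_le_vReg hT hmin hpen
  -- `u` is optimal, so exactness makes its copies equal to the parent states; its penalized cost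
  -- then bounds a cost of the original problem.
  have hz := hexact u hu fun u' hu' => hval.trans (P.vReg_le_penalizedCost hu')
  refine ⟨_, hu.1, le_trans (add_le_add le_rfl ?_) hval⟩
  refine P.le_sum_stages (Φ := fun t w => P.costToGo t (u.x t w)) (fun t ht w => ?_)
    fun w => P.costToGo_of_le le_rfl _
  rw [P.costToGo_of_lt ht]
  gcongr with m
  refine (iInf₂_le (_ : E (t + 1) × Y t m) (hu.2 t ht w m).1).trans ?_
  rw [hz t ht w m]
  exact add_le_add le_self_add le_rfl

/-! ### Convexity of the regularized cost-to-go functions -/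

/-- The objective is jointly convex in the parent state, the decision and the copy; minimize over
the copy, then over the decision. -/
theorem IsConvex.convexOn_regNode (hconv : P.IsConvex) (hpen : P.PenaltyCondition) {t : ℕ}
    (ht : t < P.T) (m : N t)
    (hQ : ConvexOn ℝ≥0 (P.F t m) fun u => P.regCostToGo (t + 1) u.1) :
    ConvexOn ℝ≥0 (P.X t) fun x => ⨅ u ∈ P.F t m, ⨅ z ∈ P.X t,
      (P.f t m z u.2 u.1 + ENNReal.ofReal (P.σ t m * P.ψ t m (x - z)) +
        P.regCostToGo (t + 1) u.1) := by
  obtain ⟨hX, hF, hf, hψ⟩ := hconv.2.2 t ht m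
  have hS : Convex ℝ ((P.X t ×ˢ P.F t m) ×ˢ P.X t) := (hX.prod hF).prod hX
  have hψ' : ConvexOn ℝ ((P.X t ×ˢ P.F t m) ×ˢ P.X t)
      fun q => P.σ t m * P.ψ t m (q.1.1 - q.2) := by
    refine ⟨hS, fun q _ q' _ a b ha hb hab => ?_⟩
    have hlin : (a • q + b • q').1.1 - (a • q + b • q').2 =
        a • (q.1.1 - q.2) + b • (q'.1.1 - q'.2) := by
      simp only [Prod.fst_add, Prod.snd_add, Prod.smul_fst, Prod.smul_snd, smul_sub]
      abel
    have h := hψ.2 (mem_univ (q.1.1 - q.2)) (mem_univ (q'.1.1 - q'.2)) ha hb hab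
    simp only [smul_eq_mul] at h ⊢
    rw [hlin]
    linarith [mul_le_mul_of_nonneg_left h (P.σ_pos t ht m).le]
  have h2 := hψ'.ofReal_comp fun q _ =>
    mul_nonneg (P.σ_pos t ht m).le (hpen.psi_nonneg ht m _)
  have h1 : ConvexOn ℝ≥0 ((P.X t ×ˢ P.F t m) ×ˢ P.X t)
      fun q => P.f t m q.2 q.1.2.2 q.1.2.1 :=
    ⟨h2.1, fun q hq q' hq' a b ha hb hab =>
      hf.2 (x := (q.2, q.1.2)) ⟨hq.2, hq.1.2⟩ (y := (q'.2, q'.1.2)) ⟨hq'.2, hq'.1.2⟩ ha hb hab⟩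
  have h3 : ConvexOn ℝ≥0 ((P.X t ×ˢ P.F t m) ×ˢ P.X t)
      fun q => P.regCostToGo (t + 1) q.1.2.1 :=
    ⟨h2.1, fun q hq q' hq' a b ha hb hab =>
      hQ.2 (x := q.1.2) hq.1.2 (y := q'.1.2) hq'.1.2 ha hb hab⟩
  have h4 : ConvexOn ℝ≥0 (P.X t ×ˢ P.F t m) fun q => ⨅ z ∈ P.X t,
      (P.f t m z q.2.2 q.2.1 + ENNReal.ofReal (P.σ t m * P.ψ t m (q.1 - z)) +
        P.regCostToGo (t + 1) q.2.1) :=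
    ConvexOn.iInf_right (Φ := fun q : (E t × (E (t + 1) × Y t m)) × E t =>
      P.f t m q.2 q.1.2.2 q.1.2.1 + ENNReal.ofReal (P.σ t m * P.ψ t m (q.1.1 - q.2)) +
        P.regCostToGo (t + 1) q.1.2.1) (hX.prod hF) ((h1.add h2).add h3)
  exact ConvexOn.iInf_right (Φ := fun q : E t × (E (t + 1) × Y t m) => ⨅ z ∈ P.X t,
      (P.f t m z q.2.2 q.2.1 + ENNReal.ofReal (P.σ t m * P.ψ t m (q.1 - z)) +
        P.regCostToGo (t + 1) q.2.1)) hX h4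

theorem IsConvex.convexOn_regCostToGo (hconv : P.IsConvex) (hpen : P.PenaltyCondition) (t : ℕ) :
    t < P.T → ConvexOn ℝ≥0 (P.X t) (P.regCostToGo t) := by
  induction t using stage_induction P.T with
  | base t ht => intro h; omega
  | step t ht ih =>
    intro _
    have hnode : ∀ m, ConvexOn ℝ≥0 (P.X t) fun x => ⨅ u ∈ P.F t m, ⨅ z ∈ P.X t,
        (P.f t m z u.2 u.1 + ENNReal.ofReal (P.σ t m * P.ψ t m (x - z)) +
          P.regCostToGo (t + 1) u.1) := by
      intro m
      refine hconv.convexOn_regNode hpen ht m ?_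
      have hF : Convex ℝ≥0 (P.F t m) := fun x hx y hy a b _ _ hab =>
        (hconv.2.2 t ht m).2.1 hx hy a.coe_nonneg b.coe_nonneg (by exact_mod_cast hab)
      refine ⟨hF, fun u hu u' hu' a b ha hb hab => ?_⟩
      by_cases h : t + 1 < P.T
      · exact (ih h).2 (P.state_mem h hu) (P.state_mem h hu') ha hb hab
      · simp [P.regCostToGo_of_le (not_lt.1 h)]
    obtain ⟨m₀⟩ := P.nonempty_children ht
    refine ⟨(hnode m₀).1, fun x hx y hy a b ha hb hab => ?_⟩
    change _ ≤ (a : ℝ≥0∞) * _ + (b : ℝ≥0∞) * _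
    rw [P.regCostToGo_of_lt ht, P.regCostToGo_of_lt ht, P.regCostToGo_of_lt ht, Finset.mul_sum,
      Finset.mul_sum, ← Finset.sum_add_distrib]
    refine Finset.sum_le_sum fun m _ => ?_
    rw [mul_left_comm (a : ℝ≥0∞), mul_left_comm (b : ℝ≥0∞), ← mul_add]
    exact mul_le_mul_right ((hnode m).2 hx hy ha hb hab) _

/-- Lipschitz extension of the regularized cost-to-go function from the state space. -/
def regExtension (P : StagewiseProgram E N Yr Y) (t : ℕ) : E t → ℝ≥0∞ :=
  infConvNorm (P.X t) (P.regCostToGo t) (LinearMap.id : E t →ₗ[ℝ] E t) (P.penaltyConst t)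

/-- The extension serves as a minorant on the whole space: biconjugation takes an infimum over all
of `E t`, not only over `X t`. -/
theorem PenaltyCondition.regExtension_eq (hpen : P.PenaltyCondition) {t : ℕ} (ht : t < P.T)
    {x : E t} (hx : x ∈ P.X t) : P.regExtension t x = P.regCostToGo t x :=
  le_antisymm (infConvNorm_le_self (π := (LinearMap.id : E t →ₗ[ℝ] E t)) hx)
    (le_iInf₂ fun _ hz => hpen.regCostToGo_le_add ht hx hz)

theorem regExtension_le {t : ℕ} {z : E t} (hz : z ∈ P.X t) (x : E t) :
    P.regExtension t x ≤ P.regCostToGo t z + ENNReal.ofReal (P.penaltyConst t * ‖x - z‖) :=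
  iInf₂_le z hz

theorem MinCondition.nonempty_X (hmin : P.MinCondition) {t : ℕ} (ht : t < P.T) :
    (P.X t).Nonempty := by
  obtain ⟨m⟩ := P.nonempty_children ht
  obtain ⟨_, _, z, hz, _⟩ := hmin.exists_lt_top ht m
  exact ⟨z, hz⟩

theorem MinCondition.regExtension_lt_top (hmin : P.MinCondition) {t : ℕ} (ht : t < P.T) (x : E t) :
    P.regExtension t x < ⊤ := by
  obtain ⟨z, hz⟩ := hmin.nonempty_X ht
  exact infConvNorm_lt_top ⟨z, hz, hmin.regCostToGo_lt_top t z⟩ x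

theorem _root_.biconjugate_le {V : Type*} [NormedAddCommGroup V] [NormedSpace ℝ V] (g : V → EReal)
    (x : V) : biconjugate g x ≤ g x :=
  iSup_le fun lam => (iInf_le _ x).trans (by simp)

/-- A subgradient of the minorant `r` at `x` gives an affine minorant of `g` that is exact for `r`
at `x`; its slope is the multiplier to insert in the supremum. -/
theorem _root_.le_biconjugate {V : Type*} [NormedAddCommGroup V] [NormedSpace ℝ V] {g : V → EReal}
    {r : V → ℝ} (hr : ∀ z, (r z : EReal) ≤ g z) {lam : StrongDual ℝ V} {x : V}
    (hlam : ∀ z, r x + lam (z - x) ≤ r z) : (r x : EReal) ≤ biconjugate g x := by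
  refine le_iSup_of_le lam (le_iInf fun z => ?_)
  calc (r x : EReal) ≤ ((r z + lam (x - z) : ℝ) : EReal) := by
        have h := hlam z
        rw [← neg_sub x z, map_neg] at h
        exact_mod_cast (by linarith)
    _ = (r z : EReal) + ((lam (x - z) : ℝ) : EReal) := EReal.coe_add _ _
    _ ≤ _ := add_le_add (hr z) le_rfl

theorem IsConvex.regExtension_le_biconjugate (hconv : P.IsConvex) (hmin : P.MinCondition)
    (hpen : P.PenaltyCondition) {t : ℕ} (ht : t < P.T) {g : E t → EReal}
    (hg : ∀ x, (P.regExtension t x : EReal) ≤ g x) (x : E t) :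
    (P.regExtension t x : EReal) ≤ biconjugate g x := by
  obtain ⟨z, hz⟩ := hmin.nonempty_X ht
  obtain ⟨lam, -, hlam⟩ := exists_subgradient_infConvNorm (LinearMap.id : E t →ₗ[ℝ] E t)
    (P.penaltyConst_nonneg ht) (hconv.convexOn_regCostToGo hpen t ht)
    ⟨z, hz, hmin.regCostToGo_lt_top t z⟩ x
  rw [← EReal.coe_ennreal_toReal (hmin.regExtension_lt_top ht x).ne]
  refine le_biconjugate (r := fun x => (P.regExtension t x).toReal) (fun z => ?_) hlam
  rw [EReal.coe_ennreal_toReal (hmin.regExtension_lt_top ht z).ne]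
  exact hg z

/-! ### Values of the subproblem oracles -/

/-- The problem is convex, penalized by norms, and approximated by linear cuts. -/
def UsesLinearCuts (P : StagewiseProgram E N Yr Y) : Prop :=
  P.IsConvex ∧ ∀ t < P.T, ∀ m,
    (∀ x, P.ψ t m x = ‖x‖) ∧ P.σ t m ≤ P.lLam t m ∧ P.lRho t m = 0

theorem _root_.EReal.coe_ennreal_add_coe {a : ℝ≥0∞} (ha : a ≠ ⊤) (r : ℝ) :
    (a : EReal) + (r : EReal) = ((a.toReal + r : ℝ) : EReal) := by
  rw [← EReal.coe_ennreal_toReal ha, ← EReal.coe_add]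

theorem _root_.EReal.ne_top_of_coe_ennreal_add_le {a : ℝ≥0∞} {r s : ℝ}
    (h : (a : EReal) + (r : EReal) ≤ (s : EReal)) : a ≠ ⊤ := by
  rintro rfl
  rw [EReal.coe_ennreal_top, EReal.top_add_coe, top_le_iff] at h
  exact EReal.coe_ne_top s h

/-- Optimal value of the forward subproblem of node `m`. -/
def Oracles.fwdValue (O : P.Oracles) (t : ℕ) (m : N t) (xa : E t) (Θ : E (t + 1) → ℝ) : ℝ :=
  (P.f t m (O.fwd t m xa Θ).z (O.fwd t m xa Θ).y (O.fwd t m xa Θ).x).toReal +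
    (P.σ t m * P.ψ t m (xa - (O.fwd t m xa Θ).z) + Θ (O.fwd t m xa Θ).x)

/-- Optimal value of the backward subproblem of node `m`. -/
def Oracles.bwdValue (O : P.Oracles) (t : ℕ) (m : N t) (xa : E t) (Θ : E (t + 1) → ℝ) : ℝ :=
  (P.f t m (O.bwd t m xa Θ).z (O.bwd t m xa Θ).y (O.bwd t m xa Θ).x).toReal +
      (O.bwd t m xa Θ).lam (xa - (O.bwd t m xa Θ).z) +
    (O.bwd t m xa Θ).rho * P.ψ t m (xa - (O.bwd t m xa Θ).z) + Θ (O.bwd t m xa Θ).x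

/-- The generalized conjugacy cut of node `m`. -/
def Oracles.cut (O : P.Oracles) (t : ℕ) (m : N t) (xa : E t) (Θ : E (t + 1) → ℝ) (x : E t) : ℝ :=
  -(O.bwd t m xa Θ).lam (xa - x) - (O.bwd t m xa Θ).rho * P.ψ t m (xa - x) + O.bwdValue t m xa Θ

/-! ### Values and cuts of a single node. -/

section Node

variable (O : P.Oracles) {t : ℕ} (ht : t < P.T) (m : N t) {xa : E t} (hxa : xa ∈ P.X t)
  {Θ : E (t + 1) → ℝ} (hΘ : LowerSemicontinuousOn Θ (Prod.fst '' P.F t m))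
include ht hxa hΘ

theorem Oracles.fwd_ne_top (hmin : P.MinCondition) :
    P.f t m (O.fwd t m xa Θ).z (O.fwd t m xa Θ).y (O.fwd t m xa Θ).x ≠ ⊤ := by
  obtain ⟨u, hu, z, hz, hf⟩ := hmin.exists_lt_top ht m
  have h := (O.fwd_spec t ht m xa hxa Θ hΘ).2.2 u hu z hz
  rw [fwdObj, fwdObj, EReal.coe_ennreal_add_coe hf.ne] at h
  exact EReal.ne_top_of_coe_ennreal_add_le h

theorem Oracles.fwdValue_le (hmin : P.MinCondition) {u : E (t + 1) × Y t m} (hu : u ∈ P.F t m)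
    {z : E t} (hz : z ∈ P.X t) (hf : P.f t m z u.2 u.1 ≠ ⊤) :
    O.fwdValue t m xa Θ ≤
      (P.f t m z u.2 u.1).toReal + (P.σ t m * P.ψ t m (xa - z) + Θ u.1) := by
  have h := (O.fwd_spec t ht m xa hxa Θ hΘ).2.2 u hu z hz
  rw [fwdObj, fwdObj, EReal.coe_ennreal_add_coe hf,
    EReal.coe_ennreal_add_coe (O.fwd_ne_top ht m hxa hΘ hmin)] at h
  exact_mod_cast h

/-- An optimal point cannot be worse than a feasible point of finite cost, so taking `toReal` of the
cost in the cuts loses nothing. -/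
theorem Oracles.bwd_ne_top (hmin : P.MinCondition) :
    P.f t m (O.bwd t m xa Θ).z (O.bwd t m xa Θ).y (O.bwd t m xa Θ).x ≠ ⊤ := by
  obtain ⟨u, hu, z, hz, hf⟩ := hmin.exists_lt_top ht m
  have h := (O.bwd_spec t ht m xa hxa Θ hΘ).2.2.2.1.trans_le
    ((iInf₂_le u hu).trans (iInf₂_le z hz))
  rw [bwdObj, bwdObj, EReal.coe_ennreal_add_coe hf.ne] at h
  exact EReal.ne_top_of_coe_ennreal_add_le h

theorem Oracles.coe_bwdValue (hmin : P.MinCondition) :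
    (O.bwdValue t m xa Θ : EReal) =
      P.bwdVal t m xa Θ (O.bwd t m xa Θ).lam (O.bwd t m xa Θ).rho := by
  rw [← (O.bwd_spec t ht m xa hxa Θ hΘ).2.2.2.1, bwdObj,
    EReal.coe_ennreal_add_coe (O.bwd_ne_top ht m hxa hΘ hmin), bwdValue]
  congr 1
  ring

theorem Oracles.bwdValue_le (hmin : P.MinCondition) {u : E (t + 1) × Y t m} (hu : u ∈ P.F t m)
    {z : E t} (hz : z ∈ P.X t) (hf : P.f t m z u.2 u.1 ≠ ⊤) :
    O.bwdValue t m xa Θ ≤ (P.f t m z u.2 u.1).toReal +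
      ((O.bwd t m xa Θ).lam (xa - z) + (O.bwd t m xa Θ).rho * P.ψ t m (xa - z) + Θ u.1) := by
  have h := (O.coe_bwdValue ht m hxa hΘ hmin).trans_le ((iInf₂_le u hu).trans (iInf₂_le z hz))
  rw [bwdObj, EReal.coe_ennreal_add_coe hf] at h
  exact_mod_cast h

/-- By maximality over the dual set, any admissible multiplier may be used to bound the value from
below; points of infinite cost impose no condition. -/
theorem Oracles.le_bwdValue (hmin : P.MinCondition) {lam : StrongDual ℝ (E t)} {rho r : ℝ}
    (hv : (lam, rho) ∈ P.dualSet t m)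
    (h : ∀ u ∈ P.F t m, ∀ z ∈ P.X t, P.f t m z u.2 u.1 ≠ ⊤ →
      r ≤ (P.f t m z u.2 u.1).toReal + (lam (xa - z) + rho * P.ψ t m (xa - z) + Θ u.1)) :
    r ≤ O.bwdValue t m xa Θ := by
  have h1 := (O.bwd_spec t ht m xa hxa Θ hΘ).2.2.2.2 _ hv
  rw [← O.coe_bwdValue ht m hxa hΘ hmin] at h1
  rw [← EReal.coe_le_coe_iff]
  refine le_trans (le_iInf₂ fun u hu => le_iInf₂ fun z hz => ?_) h1
  rw [bwdObj]
  by_cases hf : P.f t m z u.2 u.1 = ⊤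
  · rw [hf, EReal.coe_ennreal_top, EReal.top_add_coe]
    exact le_top
  · rw [EReal.coe_ennreal_add_coe hf]
    exact_mod_cast h u hu z hz hf

/-- Testing the inner minimum with the copy `z = x` makes the multiplier terms cancel against those
of the cut. No penalty remains, whence the comparison with the original cost. -/
theorem Oracles.cut_le (hmin : P.MinCondition) {x : E t} (hx : x ∈ P.X t) {u : E (t + 1) × Y t m}
    (hu : u ∈ P.F t m) (hf : P.f t m x u.2 u.1 ≠ ⊤) :
    O.cut t m xa Θ x ≤ (P.f t m x u.2 u.1).toReal + Θ u.1 := by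
  have h := O.bwdValue_le ht m hxa hΘ hmin hu hx hf
  rw [cut]
  linarith

theorem Oracles.le_cut (hpen : P.PenaltyCondition) {x : E t} (hx : x ∈ P.X t) :
    O.bwdValue t m xa Θ - (P.lLam t m + P.lRho t m) * ‖xa - x‖ ≤ O.cut t m xa Θ x := by
  obtain ⟨-, -, ⟨h1, h2, h3⟩, -, -⟩ := O.bwd_spec t ht m xa hxa Θ hΘ
  have h4 := hpen.psi_le_norm ht m hxa hx
  have h5 : (O.bwd t m xa Θ).lam (xa - x) ≤ P.lLam t m * ‖xa - x‖ :=
    (le_abs_self _).trans (((O.bwd t m xa Θ).lam.le_opNorm _).trans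
      (mul_le_mul_of_nonneg_right h1 (norm_nonneg _)))
  have h6 : (O.bwd t m xa Θ).rho * P.ψ t m (xa - x) ≤ P.lRho t m * ‖xa - x‖ :=
    mul_le_mul h3 h4 (hpen.psi_nonneg ht m _) (P.lRho_nonneg t ht m)
  rw [cut, add_mul]
  linarith

/-- The backward subproblem is at least as large as the forward subproblem with a smaller
under-approximation. -/
theorem Oracles.fwdValue_le_bwdValue (hmin : P.MinCondition)
    (hdual : P.DualBoundCondition)
    {Θ' : E (t + 1) → ℝ} (hΘ' : LowerSemicontinuousOn Θ' (Prod.fst '' P.F t m))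
    (hle : ∀ x, Θ x ≤ Θ' x) (hnonneg : ∀ x, 0 ≤ Θ' x)
    (hconvex : P.UsesLinearCuts → ConvexOn ℝ univ Θ') :
    O.fwdValue t m xa Θ ≤ O.bwdValue t m xa Θ' := by
  rcases hdual with hlin | hrho
  · obtain ⟨hψ, hσ, hρ⟩ := hlin.2 t ht m
    obtain ⟨hX, hF, hf, -⟩ := hlin.1.2.2 t ht m
    have hσ0 := (P.σ_pos t ht m).le
    have hΘc : ConvexOn ℝ (P.X t ×ˢ P.F t m) fun q => Θ' q.2.1 :=
      ⟨hX.prod hF, fun q _ q' _ a b ha hb hab =>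
        (hconvex hlin).2 (mem_univ q.2.1) (mem_univ q'.2.1) ha hb hab⟩
    -- As `Θ'` is nonnegative, `ENNReal.ofReal` does not alter it, and the nodal objective without
    -- penalty can be convolved with `σ ‖·‖`.
    have hφ : ConvexOn ℝ≥0 (P.X t ×ˢ P.F t m)
        fun q => P.f t m q.1 q.2.2 q.2.1 + ENNReal.ofReal (Θ' q.2.1) :=
      hf.add (hΘc.ofReal_comp fun q _ => hnonneg _)
    obtain ⟨u₀, hu₀, z₀, hz₀, hf₀⟩ := hmin.exists_lt_top ht m
    have hfin : ∃ q ∈ P.X t ×ˢ P.F t m,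
        P.f t m q.1 q.2.2 q.2.1 + ENNReal.ofReal (Θ' q.2.1) < ⊤ :=
      ⟨(z₀, u₀), ⟨hz₀, hu₀⟩, ENNReal.add_lt_top.2 ⟨hf₀, ENNReal.ofReal_lt_top⟩⟩
    obtain ⟨lam, hlam, hsub⟩ := exists_subgradient_infConvNorm
      (LinearMap.fst ℝ (E t) (E (t + 1) × Y t m)) hσ0 hφ hfin xa
    have hlow : O.fwdValue t m xa Θ ≤ (infConvNorm (P.X t ×ˢ P.F t m)
        (fun q => P.f t m q.1 q.2.2 q.2.1 + ENNReal.ofReal (Θ' q.2.1))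
        (LinearMap.fst ℝ (E t) (E (t + 1) × Y t m)) (P.σ t m) xa).toReal := by
      rw [← ENNReal.ofReal_le_iff_le_toReal (infConvNorm_lt_top hfin xa).ne]
      refine le_iInf₂ fun q hq => ?_
      by_cases hfq : P.f t m q.1 q.2.2 q.2.1 = ⊤
      · simp [hfq]
      · have h := O.fwdValue_le ht m hxa hΘ hmin hq.2 hq.1 hfq
        rw [hψ] at h
        dsimp only [LinearMap.fst_apply]
        rw [← ENNReal.ofReal_toReal hfq, ← ENNReal.ofReal_add ENNReal.toReal_nonneg (hnonneg _),
          ← ENNReal.ofReal_add (add_nonneg ENNReal.toReal_nonneg (hnonneg _))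
            (mul_nonneg hσ0 (norm_nonneg _))]
        refine ENNReal.ofReal_le_ofReal (h.trans ?_)
        have := hle q.2.1
        linarith
    -- The subgradient at `xa` has norm at most `σ`, hence is admissible with `ρ = 0`. It bounds the
    -- dual objective at each `z` below by the convolution at `xa`.
    refine O.le_bwdValue ht m hxa hΘ' hmin (lam := lam) (rho := 0)
      ⟨hlam.trans hσ, le_rfl, hρ.ge⟩ fun u hu z hz hfu => ?_
    have h1 := hsub z
    have h2 : (infConvNorm (P.X t ×ˢ P.F t m)
        (fun q => P.f t m q.1 q.2.2 q.2.1 + ENNReal.ofReal (Θ' q.2.1))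
        (LinearMap.fst ℝ (E t) (E (t + 1) × Y t m)) (P.σ t m) z).toReal ≤
        (P.f t m z u.2 u.1).toReal + Θ' u.1 := by
      rw [← ENNReal.toReal_ofReal (hnonneg u.1), ← ENNReal.toReal_add hfu ENNReal.ofReal_ne_top]
      exact ENNReal.toReal_mono (ENNReal.add_ne_top.2 ⟨hfu, ENNReal.ofReal_ne_top⟩)
        (infConvNorm_le_self (π := LinearMap.fst ℝ (E t) (E (t + 1) × Y t m))
          (s := (z, u)) ⟨hz, hu⟩)
    rw [← neg_sub xa z, map_neg] at h1
    linarith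
  -- With `λ = 0` and `ρ = σ` the inner problem is the forward problem for `Θ'`.
  · refine O.le_bwdValue ht m hxa hΘ' hmin (lam := 0) (rho := P.σ t m)
      ⟨by simpa using P.lLam_nonneg t ht m, (P.σ_pos t ht m).le, hrho t ht m⟩
      fun u hu z hz hfu => ?_
    have h := O.fwdValue_le ht m hxa hΘ hmin hu hz hfu
    have := hle u.1
    simp only [zero_apply]
    linarith

end Node

/-! ### Under-approximations -/

/-- Properties of the under-approximation `Θ` of the cost-to-go function of stage `t` that the
algorithm preserves. -/
structure ValidLow (P : StagewiseProgram E N Yr Y) (t : ℕ) (Θ : E t → ℝ) : Prop where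
  nonneg : ∀ x, 0 ≤ Θ x
  eq_zero : P.T ≤ t → ∀ x, Θ x = 0
  continuousOn : t < P.T → ContinuousOn Θ (P.X t)
  le_costToGo : t < P.T → ∀ x ∈ P.X t, ENNReal.ofReal (Θ x) ≤ P.costToGo t x
  convexOn : P.UsesLinearCuts → ConvexOn ℝ univ Θ

theorem validLow_zero (t : ℕ) : P.ValidLow t fun _ => 0 where
  nonneg _ := le_rfl
  eq_zero _ _ := rfl
  continuousOn _ := continuousOn_const
  le_costToGo _ _ _ := by simp
  convexOn _ := convexOn_const 0 convex_univ

/-- This is what the oracles require. For `t + 1 = T` the set `X` is not tied to the feasibility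
sets, but `Θ` vanishes there. -/
theorem ValidLow.lowerSemicontinuousOn {t : ℕ} {Θ : E (t + 1) → ℝ} (hΘ : P.ValidLow (t + 1) Θ)
    (m : N t) : LowerSemicontinuousOn Θ (Prod.fst '' P.F t m) := by
  by_cases h : t + 1 < P.T
  · rw [← P.X_succ t h m]
    exact (hΘ.continuousOn h).lowerSemicontinuousOn
  · rw [show Θ = fun _ => 0 from funext (hΘ.eq_zero (not_lt.1 h))]
    exact continuousOn_const.lowerSemicontinuousOn

theorem ValidLow.ofReal_le {t : ℕ} {Θ : E (t + 1) → ℝ} (hΘ : P.ValidLow (t + 1) Θ) {m : N t}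
    {u : E (t + 1) × Y t m} (hu : u ∈ P.F t m) :
    ENNReal.ofReal (Θ u.1) ≤ P.costToGo (t + 1) u.1 := by
  by_cases h : t + 1 < P.T
  · exact hΘ.le_costToGo h _ (P.state_mem h hu)
  · simp [hΘ.eq_zero (not_lt.1 h)]

theorem Oracles.newUnder_of_lt (O : P.Oracles) (s : P.AlgState) (xs : ∀ t, E t) {t : ℕ}
    (ht : t < P.T) (x : E t) :
    O.newUnder s xs (P.T - t) t x = max (s.lowQ t x)
      (∑ m, P.p t m * O.cut t m (xs t) (O.newUnder s xs (P.T - (t + 1)) (t + 1)) x) := by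
  rw [show P.T - t = (P.T - (t + 1)) + 1 by omega]
  rfl

theorem Oracles.newUnder_of_le (O : P.Oracles) (s : P.AlgState) (xs : ∀ t, E t) {t : ℕ}
    (ht : P.T ≤ t) : O.newUnder s xs (P.T - t) t = fun _ => 0 := by
  rw [Nat.sub_eq_zero_of_le ht]
  rfl

theorem Oracles.continuousOn_cut (O : P.Oracles) (hpen : P.PenaltyCondition) {t : ℕ}
    (ht : t < P.T) (m : N t) {xa : E t} (hxa : xa ∈ P.X t) (Θ : E (t + 1) → ℝ) :
    ContinuousOn (O.cut t m xa Θ) (P.X t) := by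
  have h := hpen.continuousOn_psi ht m hxa
  unfold cut
  fun_prop

/-- The bound `l_ρ = 0` forces `ρ = 0`, so the cut is affine. -/
theorem Oracles.convexOn_cut (O : P.Oracles) (hlin : P.UsesLinearCuts) {t : ℕ} (ht : t < P.T)
    (m : N t) {xa : E t} (hxa : xa ∈ P.X t) {Θ : E (t + 1) → ℝ}
    (hΘ : LowerSemicontinuousOn Θ (Prod.fst '' P.F t m)) :
    ConvexOn ℝ univ (O.cut t m xa Θ) := by
  obtain ⟨-, -, ⟨-, h2, h3⟩, -, -⟩ := O.bwd_spec t ht m xa hxa Θ hΘ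
  have hrho : (O.bwd t m xa Θ).rho = 0 := le_antisymm (h3.trans_eq (hlin.2 t ht m).2.2) h2
  refine ⟨convex_univ, fun x _ y _ a b ha hb hab => le_of_eq ?_⟩
  simp only [cut, hrho, map_sub, map_add, map_smul, smul_eq_mul]
  linear_combination ((O.bwd t m xa Θ).lam xa - O.bwdValue t m xa Θ) * hab

theorem _root_.ENNReal.ofReal_finset_sum_le {ι : Type*} (s : Finset ι) (g : ι → ℝ) :
    ENNReal.ofReal (∑ i ∈ s, g i) ≤ ∑ i ∈ s, ENNReal.ofReal (g i) := by
  classical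
  induction s using Finset.induction_on with
  | empty => simp
  | insert a s ha ih =>
    rw [Finset.sum_insert ha, Finset.sum_insert ha]
    exact ENNReal.ofReal_add_le.trans (add_le_add le_rfl ih)

theorem Oracles.validLow_newUnder (O : P.Oracles) (hmin : P.MinCondition)
    (hpen : P.PenaltyCondition) {s : P.AlgState} (hs : ∀ t, P.ValidLow t (s.lowQ t))
    {xs : ∀ t, E t} (hxs : ∀ t < P.T, xs t ∈ P.X t) (t : ℕ) :
    P.ValidLow t (O.newUnder s xs (P.T - t) t) := by
  induction t using stage_induction P.T with
  | base t ht =>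
    rw [O.newUnder_of_le s xs ht]
    exact validLow_zero t
  | step t ht ih =>
    set Θ := O.newUnder s xs (P.T - (t + 1)) (t + 1)
    have heq : O.newUnder s xs (P.T - t) t =
        fun x => max (s.lowQ t x) (∑ m, P.p t m * O.cut t m (xs t) Θ x) :=
      funext fun x => O.newUnder_of_lt s xs ht x
    have hlsc := ih.lowerSemicontinuousOn
    rw [heq]
    refine ⟨fun x => le_max_of_le_left ((hs t).nonneg x), fun h => absurd ht (not_lt.2 h),
      fun _ => ?_, fun _ x hx => ?_, fun hlin => ?_⟩
    · refine ((hs t).continuousOn ht).sup (continuousOn_finsetSum _ fun m _ => ?_)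
      exact continuousOn_const.mul (O.continuousOn_cut hpen ht m (hxs t ht) Θ)
    · rw [ENNReal.ofReal_max]
      refine max_le ((hs t).le_costToGo ht x hx) ?_
      rw [P.costToGo_of_lt ht]
      refine (ENNReal.ofReal_finset_sum_le _ _).trans (Finset.sum_le_sum fun m _ => ?_)
      rw [ENNReal.ofReal_mul (P.p_pos t ht m).le]
      refine mul_le_mul_right (le_iInf₂ fun u hu => ?_) _
      by_cases hf : P.f t m x u.2 u.1 = ⊤
      · simp [hf]
      · refine (ENNReal.ofReal_le_ofReal
          (O.cut_le ht m (hxs t ht) (hlsc m) hmin hx hu hf)).trans ?_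
        rw [ENNReal.ofReal_add ENNReal.toReal_nonneg (ih.nonneg _), ENNReal.ofReal_toReal hf]
        exact add_le_add le_rfl (ih.ofReal_le hu)
    · refine ((hs t).convexOn hlin).sup ?_
      refine ⟨convex_univ, fun x _ y _ a b ha hb hab => ?_⟩
      rw [smul_eq_mul, smul_eq_mul, Finset.mul_sum, Finset.mul_sum, ← Finset.sum_add_distrib]
      refine Finset.sum_le_sum fun m _ => ?_
      have h := (O.convexOn_cut hlin ht m (hxs t ht) (hlsc m)).2 (mem_univ x) (mem_univ y)
        ha hb hab
      have h' := mul_le_mul_of_nonneg_left h (P.p_pos t ht m).le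
      simp only [smul_eq_mul] at h'
      linarith

/-! ### Over-approximations -/

/-- Upper value of node `m`, from its forward solution. -/
def Oracles.upperValue (O : P.Oracles) (t : ℕ) (m : N t) (xa : E t) (Θ : E (t + 1) → ℝ)
    (Ψ : E (t + 1) → EReal) : EReal :=
  (P.f t m (O.fwd t m xa Θ).z (O.fwd t m xa Θ).y (O.fwd t m xa Θ).x : EReal) +
    ((P.σ t m * P.ψ t m (xa - (O.fwd t m xa Θ).z) : ℝ) : EReal) + Ψ (O.fwd t m xa Θ).x

/-- Upper cut of stage `t` at the trial state `xs t`. -/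
def Oracles.upperCut (O : P.Oracles) (s : P.AlgState) (xs : ∀ t, E t) (t : ℕ)
    (Ψ : E (t + 1) → EReal) (x : E t) : EReal :=
  ∑ m, (P.p t m : EReal) * (O.upperValue t m (xs t) (s.lowQ (t + 1)) Ψ +
    ((P.σ t m * ‖x - xs t‖ : ℝ) : EReal))

theorem Oracles.newOver_of_lt (O : P.Oracles) (s : P.AlgState) (xs : ∀ t, E t) {t : ℕ}
    (ht : t < P.T) :
    O.newOver s xs (P.T - t) t =
      (open Classical in if P.IsConvex then
        biconjugate fun x => min (s.upQ t x)
          (O.upperCut s xs t (O.newOver s xs (P.T - (t + 1)) (t + 1)) x)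
      else fun x => min (s.upQ t x)
        (O.upperCut s xs t (O.newOver s xs (P.T - (t + 1)) (t + 1)) x)) := by
  rw [show P.T - t = (P.T - (t + 1)) + 1 by omega]
  rfl

theorem Oracles.newOver_of_le (O : P.Oracles) (s : P.AlgState) (xs : ∀ t, E t) {t : ℕ}
    (ht : P.T ≤ t) : O.newOver s xs (P.T - t) t = fun _ => 0 := by
  rw [Nat.sub_eq_zero_of_le ht]
  rfl

theorem Oracles.newOver_le (O : P.Oracles) (s : P.AlgState) (xs : ∀ t, E t) {t : ℕ}
    (ht : t < P.T) (x : E t) :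
    O.newOver s xs (P.T - t) t x ≤ min (s.upQ t x)
      (O.upperCut s xs t (O.newOver s xs (P.T - (t + 1)) (t + 1)) x) := by
  rw [O.newOver_of_lt s xs ht]
  split_ifs
  · exact biconjugate_le _ x
  · exact le_rfl

theorem _root_.EReal.coe_ennreal_finset_sum {ι : Type*} (s : Finset ι) (g : ι → ℝ≥0∞) :
    ((∑ i ∈ s, g i : ℝ≥0∞) : EReal) = ∑ i ∈ s, (g i : EReal) := by
  classical
  induction s using Finset.induction_on with
  | empty => simp
  | insert a s ha ih => rw [Finset.sum_insert ha, Finset.sum_insert ha, EReal.coe_ennreal_add, ih]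

theorem _root_.EReal.coe_finset_sum {ι : Type*} (s : Finset ι) (g : ι → ℝ) :
    ((∑ i ∈ s, g i : ℝ) : EReal) = ∑ i ∈ s, (g i : EReal) := by
  classical
  induction s using Finset.induction_on with
  | empty => simp
  | insert a s ha ih => rw [Finset.sum_insert ha, Finset.sum_insert ha, EReal.coe_add, ih]

theorem _root_.EReal.coe_ennreal_ofReal_of_nonneg {r : ℝ} (hr : 0 ≤ r) :
    ((ENNReal.ofReal r : ℝ≥0∞) : EReal) = (r : EReal) := by
  rw [EReal.coe_ennreal_ofReal, max_eq_left hr]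

/-- Properties of the over-approximation `Ψ` of the cost-to-go function of stage `t` that the
algorithm preserves. -/
structure ValidUp (P : StagewiseProgram E N Yr Y) (t : ℕ) (Ψ : E t → EReal) : Prop where
  eq_zero : P.T ≤ t → ∀ x, Ψ x = 0
  regExtension_le : t < P.T → ∀ x, (P.regExtension t x : EReal) ≤ Ψ x

theorem ValidUp.regCostToGo_le {t : ℕ} {Ψ : E (t + 1) → EReal} (hΨ : P.ValidUp (t + 1) Ψ)
    (hpen : P.PenaltyCondition) {m : N t} {u : E (t + 1) × Y t m} (hu : u ∈ P.F t m) :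
    (P.regCostToGo (t + 1) u.1 : EReal) ≤ Ψ u.1 := by
  by_cases h : t + 1 < P.T
  · rw [← hpen.regExtension_eq h (P.state_mem h hu)]
    exact hΨ.regExtension_le h _
  · rw [hΨ.eq_zero (not_lt.1 h), P.regCostToGo_of_le (not_lt.1 h)]
    simp

/-- The extension is at most its value at the trial state plus a multiple of the distance, and the
forward solution, although computed with the under-approximation, is feasible in the regularized
nodal problem. -/
theorem Oracles.regExtension_le_upperCut (O : P.Oracles) (hpen : P.PenaltyCondition)
    {s : P.AlgState} (hs : ∀ t, P.ValidLow t (s.lowQ t)) {xs : ∀ t, E t}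
    {t : ℕ} (ht : t < P.T) (hxs : xs t ∈ P.X t)
    {Ψ : E (t + 1) → EReal} (hΨ : P.ValidUp (t + 1) Ψ) (x : E t) :
    (P.regExtension t x : EReal) ≤ O.upperCut s xs t Ψ x := by
  have hle := P.regExtension_le hxs x
  have hsum : P.regCostToGo t (xs t) + ENNReal.ofReal (P.penaltyConst t * ‖x - xs t‖) =
      ∑ m, ENNReal.ofReal (P.p t m) * ((⨅ u ∈ P.F t m, ⨅ z ∈ P.X t,
        (P.f t m z u.2 u.1 + ENNReal.ofReal (P.σ t m * P.ψ t m (xs t - z)) +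
          P.regCostToGo (t + 1) u.1)) + ENNReal.ofReal (P.σ t m * ‖x - xs t‖)) := by
    rw [penaltyConst, Finset.sum_mul, ENNReal.ofReal_sum_of_nonneg, P.regCostToGo_of_lt ht,
      ← Finset.sum_add_distrib]
    · refine Finset.sum_congr rfl fun m _ => ?_
      rw [mul_assoc, ENNReal.ofReal_mul (P.p_pos t ht m).le, mul_add]
    · exact fun m _ => mul_nonneg (mul_nonneg (P.p_pos t ht m).le (P.σ_pos t ht m).le)
        (norm_nonneg _)
  rw [hsum] at hle
  refine (EReal.coe_ennreal_le_coe_ennreal_iff.2 hle).trans ?_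
  rw [EReal.coe_ennreal_finset_sum]
  refine Finset.sum_le_sum fun m _ => ?_
  have hp : (0 : EReal) ≤ (P.p t m : EReal) := by exact_mod_cast (P.p_pos t ht m).le
  rw [EReal.coe_ennreal_mul, EReal.coe_ennreal_add,
    EReal.coe_ennreal_ofReal_of_nonneg (P.p_pos t ht m).le,
    EReal.coe_ennreal_ofReal_of_nonneg (mul_nonneg (P.σ_pos t ht m).le (norm_nonneg _))]
  refine mul_le_mul_of_nonneg_left (add_le_add ?_ le_rfl) hp
  obtain ⟨hF, hX, -⟩ := O.fwd_spec t ht m (xs t) hxs _ ((hs (t + 1)).lowerSemicontinuousOn m)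
  refine (EReal.coe_ennreal_le_coe_ennreal_iff.2
    ((iInf₂_le _ hF).trans (iInf₂_le _ hX))).trans ?_
  rw [EReal.coe_ennreal_add, EReal.coe_ennreal_add, EReal.coe_ennreal_ofReal_of_nonneg
    (mul_nonneg (P.σ_pos t ht m).le (hpen.psi_nonneg ht m _))]
  exact add_le_add le_rfl (hΨ.regCostToGo_le hpen hF)

theorem Oracles.validUp_newOver (O : P.Oracles) (hmin : P.MinCondition)
    (hpen : P.PenaltyCondition) {s : P.AlgState} (hs : ∀ t, P.ValidLow t (s.lowQ t))
    (hs' : ∀ t, P.ValidUp t (s.upQ t))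
    {xs : ∀ t, E t} (hxs : ∀ t < P.T, xs t ∈ P.X t) (t : ℕ) :
    P.ValidUp t (O.newOver s xs (P.T - t) t) := by
  induction t using stage_induction P.T with
  | base t ht =>
    rw [O.newOver_of_le s xs ht]
    exact ⟨fun _ _ => rfl, fun h => absurd h (not_lt.2 ht)⟩
  | step t ht ih =>
    refine ⟨fun h => absurd ht (not_lt.2 h), fun _ x => ?_⟩
    have hg : ∀ x, (P.regExtension t x : EReal) ≤ min (s.upQ t x)
        (O.upperCut s xs t (O.newOver s xs (P.T - (t + 1)) (t + 1)) x) := fun x =>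
      le_min ((hs' t).regExtension_le ht x)
        (O.regExtension_le_upperCut hpen hs ht (hxs t ht) ih x)
    rw [O.newOver_of_lt s xs ht]
    split_ifs with hconv
    · exact hconv.regExtension_le_biconjugate hmin hpen ht hg x
    · exact hg x

/-! ### Invariants of the algorithm -/

/-- The invariants of the states of the algorithm. -/
structure AlgState.Valid (O : P.Oracles) (s : P.AlgState) : Prop where
  low : ∀ t, P.ValidLow t (s.lowQ t)
  up : ∀ t, P.ValidUp t (s.upQ t)
  root_eq : s.root = O.root (s.lowQ 0)
  lower_eq : s.lower = (P.f₀ s.root.2 s.root.1 : EReal) + (s.lowQ 0 s.root.1 : EReal)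
  upper_le : s.upper ≤ (P.f₀ s.root.2 s.root.1 : EReal) + s.upQ 0 s.root.1
  best : s.upper = ⊤ ∨ s.best ∈ P.F₀ ∧
    ((P.f₀ s.best.2 s.best.1 + P.regCostToGo 0 s.best.1 : ℝ≥0∞) : EReal) ≤ s.upper

theorem Oracles.root_mem (O : P.Oracles) (hT : 1 ≤ P.T) {Θ : E 0 → ℝ} (hΘ : P.ValidLow 0 Θ) :
    O.root Θ ∈ P.F₀ ∧ ∀ u ∈ P.F₀, P.rootObj Θ (O.root Θ) ≤ P.rootObj Θ u :=
  O.root_spec Θ (hΘ.continuousOn hT).lowerSemicontinuousOn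

theorem AlgState.Valid.root_mem {O : P.Oracles} {s : P.AlgState} (hs : s.Valid O) (hT : 1 ≤ P.T) :
    s.root ∈ P.F₀ := by
  rw [hs.root_eq]
  exact (O.root_mem hT (hs.low 0)).1

theorem AlgState.Valid.forwardState_mem {O : P.Oracles} {s : P.AlgState} (hs : s.Valid O)
    (S : SelectionRule N) (i t : ℕ) (ht : t < P.T) : O.forwardState S i s t ∈ P.X t := by
  induction t with
  | zero =>
    rw [P.X_zero]
    exact mem_image_of_mem _ (hs.root_mem ht)
  | succ t ih =>
    have ht' : t < P.T := by omega
    exact P.state_mem ht (O.fwd_spec t ht' _ _ (ih ht') _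
      ((hs.low (t + 1)).lowerSemicontinuousOn _)).1

theorem Oracles.valid_init (O : P.Oracles) (hT : 1 ≤ P.T) : O.init.Valid O where
  low := validLow_zero
  up t := ⟨fun ht _ => if_neg (not_lt.2 ht), fun ht x => by simp [init, ht]⟩
  root_eq := rfl
  lower_eq := by simp [init]
  upper_le := by
    have : (0 < P.T) := hT
    simp only [init, this, if_true]
    rw [EReal.add_top_of_ne_bot (EReal.coe_ennreal_ne_bot _)]
  best := Or.inl rfl

theorem Oracles.valid_step (O : P.Oracles) (hT : 1 ≤ P.T) (hmin : P.MinCondition)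
    (hpen : P.PenaltyCondition) (S : SelectionRule N) (i : ℕ) {s : P.AlgState} (hs : s.Valid O) :
    (O.step S i s).Valid O := by
  have hxs := hs.forwardState_mem S i
  have hlow := O.validLow_newUnder hmin hpen hs.low hxs
  have hup := O.validUp_newOver hmin hpen hs.low hs.up hxs
  have hmem := (O.root_mem hT (hlow 0)).1
  refine ⟨hlow, hup, rfl, rfl, ?_, ?_⟩
  · simp only [step]
    split_ifs with h
    · exact le_rfl
    · exact not_lt.1 h
  · simp only [step]
    split_ifs with h
    · refine Or.inr ⟨hmem, ?_⟩
      rw [EReal.coe_ennreal_add, ← hpen.regExtension_eq hT (P.X_zero ▸ mem_image_of_mem _ hmem)]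
      exact add_le_add le_rfl ((hup 0).regExtension_le hT _)
    · exact hs.best

theorem Oracles.valid_run (O : P.Oracles) (hT : 1 ≤ P.T) (hmin : P.MinCondition)
    (hpen : P.PenaltyCondition) (S : SelectionRule N) (i : ℕ) : (O.run S i).Valid O := by
  induction i with
  | zero => exact O.valid_init hT
  | succ i ih => exact O.valid_step hT hmin hpen S i ih

/-- LB minimizes an under-approximation of the original problem, whose value is at most `vReg` by
exactness. -/
theorem AlgState.Valid.lower_le_vReg {O : P.Oracles} {s : P.AlgState} (hs : s.Valid O)
    (hT : 1 ≤ P.T) (hmin : P.MinCondition) (hpen : P.PenaltyCondition) (hexact : P.ExactPenalty) :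
    s.lower ≤ (P.vReg : EReal) := by
  obtain ⟨u, hu, hval⟩ := hexact.exists_root_le_vReg hT hmin hpen
  have h := (O.root_mem hT (hs.low 0)).2 u hu
  rw [← hs.root_eq, rootObj, ← hs.lower_eq, rootObj] at h
  refine h.trans (le_trans ?_ (EReal.coe_ennreal_le_coe_ennreal_iff.2 hval))
  rw [EReal.coe_ennreal_add, ← EReal.coe_ennreal_ofReal_of_nonneg ((hs.low 0).nonneg _)]
  refine add_le_add le_rfl (EReal.coe_ennreal_le_coe_ennreal_iff.2 ?_)
  exact (hs.low 0).le_costToGo hT _ (P.X_zero ▸ mem_image_of_mem _ hu)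

theorem AlgState.Valid.root_cost_ne_top {O : P.Oracles} {s : P.AlgState} (hs : s.Valid O)
    (hT : 1 ≤ P.T) (hmin : P.MinCondition) (hpen : P.PenaltyCondition) (hexact : P.ExactPenalty) :
    P.f₀ s.root.2 s.root.1 ≠ ⊤ := by
  have h := hs.lower_le_vReg hT hmin hpen hexact
  rw [hs.lower_eq, ← EReal.coe_ennreal_toReal hmin.vReg_lt_top.ne] at h
  exact EReal.ne_top_of_coe_ennreal_add_le h

/-- On termination, the incumbent is an approximate solution of the regularized problem. -/
theorem AlgState.Valid.isOptimalRoot_best {O : P.Oracles} {s : P.AlgState} (hs : s.Valid O)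
    (hT : 1 ≤ P.T) (hmin : P.MinCondition) (hpen : P.PenaltyCondition) (hexact : P.ExactPenalty)
    {η : ℝ} (hη : 0 ≤ η) (h : s.upper - s.lower ≤ (η : EReal)) : P.IsOptimalRoot η s.best := by
  have hle := hs.lower_le_vReg hT hmin hpen hexact
  have hlow : s.lower = ((P.f₀ s.root.2 s.root.1).toReal + s.lowQ 0 s.root.1 : ℝ) := by
    rw [hs.lower_eq, EReal.coe_ennreal_add_coe (hs.root_cost_ne_top hT hmin hpen hexact)]
  have hup : s.upper ≤ (η : EReal) + s.lower := by
    rw [hlow] at h ⊢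
    rwa [EReal.sub_le_iff_le_add (Or.inl (EReal.coe_ne_bot _)) (Or.inl (EReal.coe_ne_top _))] at h
  rcases hs.best with htop | ⟨hmem, hbest⟩
  · rw [htop, hlow, ← EReal.coe_add, top_le_iff] at hup
    exact absurd hup (EReal.coe_ne_top _)
  · refine ⟨hmem, EReal.coe_ennreal_le_coe_ennreal_iff.1 (hbest.trans (hup.trans ?_))⟩
    rw [EReal.coe_ennreal_add, EReal.coe_ennreal_ofReal_of_nonneg hη, add_comm]
    exact add_le_add hle le_rfl

/-! ### Approximation gaps -/

/-- The approximation gap of stage `t` at `x` is at most `δ`. -/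
def AlgState.GapLe (s : P.AlgState) (t : ℕ) (x : E t) (δ : ℝ) : Prop :=
  s.upQ t x ≤ ((s.lowQ t x + δ : ℝ) : EReal)

theorem AlgState.Valid.upQ_step_le {O : P.Oracles} {s : P.AlgState} (hs : s.Valid O)
    (S : SelectionRule N) (i t : ℕ) (x : E t) : (O.step S i s).upQ t x ≤ s.upQ t x := by
  obtain ht | ht := lt_or_ge t P.T
  · exact (O.newOver_le s _ ht x).trans (min_le_left _ _)
  · rw [(hs.up t).eq_zero ht]
    change O.newOver s _ (P.T - t) t x ≤ 0
    rw [O.newOver_of_le s _ ht]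

theorem AlgState.Valid.lowQ_le_step {O : P.Oracles} {s : P.AlgState} (hs : s.Valid O)
    (S : SelectionRule N) (i t : ℕ) (x : E t) : s.lowQ t x ≤ (O.step S i s).lowQ t x := by
  change _ ≤ O.newUnder s _ (P.T - t) t x
  obtain ht | ht := lt_or_ge t P.T
  · rw [O.newUnder_of_lt s _ ht]
    exact le_max_left _ _
  · rw [(hs.low t).eq_zero ht, O.newUnder_of_le s _ ht]

theorem Oracles.gapLe_run_mono (O : P.Oracles) (hT : 1 ≤ P.T) (hmin : P.MinCondition)
    (hpen : P.PenaltyCondition) (S : SelectionRule N) {i j : ℕ} (hij : i ≤ j) {t : ℕ} {x : E t}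
    {δ : ℝ} (h : (O.run S i).GapLe t x δ) : (O.run S j).GapLe t x δ := by
  induction j, hij using Nat.le_induction with
  | base => exact h
  | succ j _ ih =>
    have hs := O.valid_run hT hmin hpen S j
    refine (hs.upQ_step_le S j t x).trans (ih.trans ?_)
    exact_mod_cast add_le_add (hs.lowQ_le_step S j t x) le_rfl

/-- The trial state comes from a node with the largest gap, so a bound there holds for the forward
solutions of all siblings. -/
theorem AlgState.Valid.gapLe_fwd {O : P.Oracles} {s : P.AlgState}
    (S : SelectionRule N) (i : ℕ) {t : ℕ} {δ : ℝ}
    (h : s.GapLe (t + 1) (O.forwardState S i s (t + 1)) δ) (m : N t) :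
    s.GapLe (t + 1) (O.fwd t m (O.forwardState S i s t) (s.lowQ (t + 1))).x δ := by
  let γ : N t → EReal := fun m =>
    s.upQ (t + 1) (O.fwd t m (O.forwardState S i s t) (s.lowQ (t + 1))).x -
      (s.lowQ (t + 1) (O.fwd t m (O.forwardState S i s t) (s.lowQ (t + 1))).x : EReal)
  have hiff : ∀ m, γ m ≤ (δ : EReal) ↔
      s.GapLe (t + 1) (O.fwd t m (O.forwardState S i s t) (s.lowQ (t + 1))).x δ := fun m => by
    rw [EReal.sub_le_iff_le_add (Or.inl (EReal.coe_ne_bot _)) (Or.inl (EReal.coe_ne_top _)),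
      GapLe, ← EReal.coe_add, add_comm δ]
  exact (hiff m).1 ((S.sel_max i t γ m).trans ((hiff (S.sel i t γ)).2 h))

/-- One iteration closes the gap of a stage near its trial state, up to the gap of the next stage
at its trial state. -/
theorem AlgState.Valid.gapLe_step {O : P.Oracles} {s : P.AlgState} (hs : s.Valid O)
    (hT : 1 ≤ P.T) (hmin : P.MinCondition) (hpen : P.PenaltyCondition)
    (hdual : P.DualBoundCondition) (S : SelectionRule N) (i : ℕ) {t : ℕ} (ht : t < P.T) {δ : ℝ}
    (h : s.GapLe (t + 1) (O.forwardState S i s (t + 1)) δ) {x : E t} (hx : x ∈ P.X t) :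
    (O.step S i s).GapLe t x
      (δ + 2 * P.lipConst t * ‖x - O.forwardState S i s t‖) := by
  set xs := O.forwardState S i s
  have hxs := hs.forwardState_mem S i t ht
  have hs' := O.valid_step hT hmin hpen S i hs
  set Θ := s.lowQ (t + 1)
  set Θ' := (O.step S i s).lowQ (t + 1)
  have hlsc := (hs.low (t + 1)).lowerSemicontinuousOn
  have hlsc' := (hs'.low (t + 1)).lowerSemicontinuousOn
  -- The upper value replaces the old `Θ` in the forward value by the new over-approximation, which
  -- costs at most the old gap `δ` at the forward solution.
  have hupper : ∀ m, O.upperValue t m (xs t) Θ ((O.step S i s).upQ (t + 1)) ≤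
      ((O.fwdValue t m (xs t) Θ + δ : ℝ) : EReal) := by
    intro m
    have hgap := (hs.upQ_step_le S i (t + 1) _).trans (gapLe_fwd S i h m)
    rw [Oracles.upperValue, EReal.coe_ennreal_add_coe (O.fwd_ne_top ht m hxs (hlsc m) hmin)]
    refine (add_le_add le_rfl hgap).trans ?_
    rw [← EReal.coe_add, EReal.coe_le_coe_iff, Oracles.fwdValue]
    exact le_of_eq (by ring)
  -- At the trial state the new cut is at least the forward value; away from it the cut drops at
  -- rate at most `l_λ + l_ρ`.
  have hcut : ∀ m, O.fwdValue t m (xs t) Θ - (P.lLam t m + P.lRho t m) * ‖x - xs t‖ ≤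
      O.cut t m (xs t) Θ' x := by
    intro m
    have h1 := O.fwdValue_le_bwdValue ht m hxs (hlsc m) hmin hdual (hlsc' m)
      (hs.lowQ_le_step S i (t + 1)) (hs'.low (t + 1)).nonneg (hs'.low (t + 1)).convexOn
    have h2 := O.le_cut ht m hxs (hlsc' m) hpen hx
    rw [norm_sub_rev]
    linarith
  have hlow : ∑ m, P.p t m * O.cut t m (xs t) Θ' x ≤ (O.step S i s).lowQ t x := by
    refine (le_max_right _ _).trans_eq (O.newUnder_of_lt s xs ht x).symm
  have hup : (O.step S i s).upQ t x ≤ O.upperCut s xs t ((O.step S i s).upQ (t + 1)) x :=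
    (O.newOver_le s _ ht x).trans (min_le_right _ _)
  have hsum : O.upperCut s xs t ((O.step S i s).upQ (t + 1)) x ≤
      ((∑ m, P.p t m * (O.fwdValue t m (xs t) Θ + δ + P.σ t m * ‖x - xs t‖) : ℝ) : EReal) := by
    rw [EReal.coe_finset_sum]
    refine Finset.sum_le_sum fun m _ => ?_
    rw [EReal.coe_mul (P.p t m), EReal.coe_add (O.fwdValue t m (xs t) Θ + δ)]
    exact mul_le_mul_of_nonneg_left (add_le_add (hupper m) le_rfl)
      (by exact_mod_cast (P.p_pos t ht m).le)
  refine (hup.trans hsum).trans (EReal.coe_le_coe_iff.2 ?_)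
  refine le_trans ?_ (add_le_add hlow le_rfl)
  -- The upper cut has slope `σ ≤ l_λ + l_ρ`; together with the slope of the lower cut this makes
  -- the factor `2`.
  have hδ : δ = ∑ m, P.p t m * δ := by rw [← Finset.sum_mul, P.p_sum t ht, one_mul]
  rw [hδ, lipConst, Finset.mul_sum, Finset.sum_mul, ← Finset.sum_add_distrib,
    ← Finset.sum_add_distrib, ← hδ]
  refine Finset.sum_le_sum fun m _ => ?_
  have hσ := mul_le_mul_of_nonneg_right (hdual.sigma_le ht m) (norm_nonneg (x - xs t))
  have := mul_le_mul_of_nonneg_left (add_le_add (hcut m) hσ) (P.p_pos t ht m).le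
  linarith

theorem _root_.Nat.exists_lt_not_and_succ {p : ℕ → Prop} {n : ℕ} (h0 : ¬p 0) (hn : p n) :
    ∃ t < n, ¬p t ∧ p (t + 1) := by
  induction n with
  | zero => exact absurd hn h0
  | succ n ih =>
    by_cases h : p n
    · obtain ⟨t, ht, h⟩ := ih h
      exact ⟨t, by omega, h⟩
    · exact ⟨n, by omega, h, hn⟩

/-- Before each iteration of the algorithm there is a stage at whose trial state the gap is large,
while the gap of the next stage at its trial state is small. -/
theorem AlgState.Valid.exists_stage {O : P.Oracles} {s : P.AlgState} (hs : s.Valid O)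
    (hT : 1 ≤ P.T) (hmin : P.MinCondition) (hpen : P.PenaltyCondition) (hexact : P.ExactPenalty)
    (S : SelectionRule N) (i : ℕ) {ε : ℝ}
    (h : ¬s.upper - s.lower ≤ ((P.T * ε : ℝ) : EReal)) :
    ∃ t < P.T, ¬s.GapLe t (O.forwardState S i s t) ((P.T - t) * ε) ∧
      s.GapLe (t + 1) (O.forwardState S i s (t + 1)) ((P.T - t - 1) * ε) := by
  have h0 : ¬s.GapLe 0 (O.forwardState S i s 0) ((P.T - (0 : ℕ)) * ε) := by
    intro h0
    refine h ?_
    have hf := hs.root_cost_ne_top hT hmin hpen hexact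
    rw [hs.lower_eq, EReal.coe_ennreal_add_coe hf,
      EReal.sub_le_iff_le_add (Or.inl (EReal.coe_ne_bot _)) (Or.inl (EReal.coe_ne_top _))]
    refine hs.upper_le.trans ((add_le_add le_rfl h0).trans ?_)
    rw [← EReal.coe_add]
    simp only [Oracles.forwardState, Nat.cast_zero, sub_zero]
    rw [EReal.coe_ennreal_add_coe hf, EReal.coe_le_coe_iff]
    exact le_of_eq (by ring)
  have hend : s.GapLe P.T (O.forwardState S i s P.T) ((P.T - P.T) * ε) := by
    rw [GapLe, (hs.up P.T).eq_zero le_rfl, (hs.low P.T).eq_zero le_rfl]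
    simp
  -- The thresholds `(T - t) ε` fall by `ε` per stage; this `ε` is the allowance spent on the
  -- distance to the trial state.
  obtain ⟨t, ht, h1, h2⟩ := Nat.exists_lt_not_and_succ
    (p := fun t => s.GapLe t (O.forwardState S i s t) ((P.T - t) * ε)) h0 hend
  refine ⟨t, ht, h1, ?_⟩
  rwa [Nat.cast_succ, ← sub_sub] at h2

/-! ### The iteration bound -/

theorem Oracles.card_le_of_not_terminated [∀ t, FiniteDimensional ℝ (E t)] (O : P.Oracles)
    (S : SelectionRule N) (hT : 1 ≤ P.T) (hmin : P.MinCondition) (hpen : P.PenaltyCondition)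
    (hexact : P.ExactPenalty) (hdual : P.DualBoundCondition) {L D ε : ℝ} {d : ℕ}
    (hL : ∀ t < P.T, P.lipConst t ≤ L)
    (hd : ∀ t < P.T, Module.finrank ℝ (E t) ≤ d)
    (hD : ∀ t < P.T, ∃ (c : E t) (r : ℝ), P.X t ⊆ Metric.closedBall c r ∧ 2 * r ≤ D)
    (hε : 0 < ε) {M : ℕ}
    (hM : ∀ j < M, ¬(O.run S j).upper - (O.run S j).lower ≤ ((P.T * ε : ℝ) : EReal)) :
    (M : ℝ) ≤ P.T * (1 + 2 * L * D / ε) ^ d := by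
  classical
  have hvalid := O.valid_run hT hmin hpen S
  -- Positivity comes from `σ > 0` and the dual bounds; it permits division by `2 L`.
  have hLpos : 0 < L := (P.penaltyConst_pos hT).trans_le ((hdual.penaltyConst_le hT).trans (hL 0 hT))
  let x : ∀ _ t, E t := fun j t => O.forwardState S j (O.run S j) t
  have hx : ∀ j, ∀ t < P.T, x j t ∈ P.X t := fun j => (hvalid j).forwardState_mem S j
  have hstage : ∀ j, ∃ t, j < M → t < P.T ∧
      ¬(O.run S j).GapLe t (x j t) ((P.T - t) * ε) ∧
      (O.run S j).GapLe (t + 1) (x j (t + 1)) ((P.T - t - 1) * ε) := by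
    intro j
    by_cases hj : j < M
    · obtain ⟨t, ht⟩ := (hvalid j).exists_stage hT hmin hpen hexact S j (hM j hj)
      exact ⟨t, fun _ => ht⟩
    · exact ⟨0, fun h => absurd h hj⟩
  choose τ hτ using hstage
  -- Were the later state closer, iteration `j` would already have pushed the gap there to at most
  -- `(T - t - 1) ε + ε`, against the choice of the stage for `j'`.
  have hsep : ∀ j j', j < j' → j' < M → τ j = τ j' →
      ε / (2 * L) ≤ ‖x j' (τ j) - x j (τ j)‖ := by
    intro j j' hjj hj' heq
    obtain ⟨ht, -, hsmall⟩ := hτ j (hjj.trans hj')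
    obtain ⟨-, hlarge, -⟩ := hτ j' hj'
    rw [← heq] at hlarge
    have hgap := O.gapLe_run_mono hT hmin hpen S (Nat.succ_le_of_lt hjj)
      ((hvalid j).gapLe_step hT hmin hpen hdual S j ht hsmall (hx j' _ ht))
    by_contra hlt
    rw [not_le, lt_div_iff₀ (by positivity)] at hlt
    refine hlarge (hgap.trans (EReal.coe_le_coe_iff.2 (add_le_add le_rfl ?_)))
    have h1 := mul_le_mul_of_nonneg_right (hL _ ht) (norm_nonneg (x j' (τ j) - x j (τ j)))
    change (P.T - (τ j : ℝ) - 1) * ε + 2 * P.lipConst (τ j) * ‖x j' (τ j) - x j (τ j)‖ ≤ _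
    linarith
  have hcard : ∀ t ∈ Finset.range P.T,
      (((Finset.range M).filter fun j => τ j = t).card : ℝ) ≤ (1 + 2 * L * D / ε) ^ d := by
    intro t ht
    rw [Finset.mem_range] at ht
    have hsep' : ∀ j ∈ (Finset.range M).filter fun j => τ j = t,
        ∀ j' ∈ (Finset.range M).filter fun j => τ j = t, j ≠ j' →
        ε / (2 * L) ≤ ‖x j t - x j' t‖ := by
      intro j hj j' hj' hne
      simp only [Finset.mem_filter, Finset.mem_range] at hj hj'
      obtain ⟨hjM, rfl⟩ := hj
      rcases lt_or_gt_of_ne hne with h | h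
      · rw [norm_sub_rev]
        exact hsep j j' h hj'.1 hj'.2.symm
      · have := hsep j' j h hjM hj'.2
        rwa [hj'.2] at this
    have hδ : 0 < ε / (2 * L) := by positivity
    -- Separated states are distinct, so counting states counts iterations.
    have hinj : Set.InjOn (fun j => x j t) ((Finset.range M).filter fun j => τ j = t) := by
      intro j hj j' hj' heq
      by_contra hne
      have := hsep' j hj j' hj' hne
      simp only at heq
      rw [heq, sub_self, norm_zero] at this
      linarith
    obtain ⟨c, r, hball, hr⟩ := hD t ht
    have hr0 : 0 ≤ r := dist_nonneg.trans (Metric.mem_closedBall.1 (hball (hx 0 t ht)))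
    have hpack := Finset.card_le_of_pairwise_separated
      (((Finset.range M).filter fun j => τ j = t).image fun j => x j t) c hr0 hδ ?_ ?_
    · rw [Finset.card_image_of_injOn hinj] at hpack
      refine hpack.trans ?_
      -- The diameter bound `2 r ≤ D` and the separation `ε / (2 L)` give `2 L D / ε`.
      have hbase : 1 + 2 * r / (ε / (2 * L)) ≤ 1 + 2 * L * D / ε := by
        rw [div_div_eq_mul_div]
        gcongr 1 + ?_ / ε
        nlinarith
      have h0 : 0 ≤ 2 * r / (ε / (2 * L)) := by positivity
      exact (pow_le_pow_left₀ (by linarith) hbase _).trans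
        (pow_le_pow_right₀ (by linarith) (hd t ht))
    · intro y hy
      obtain ⟨j, -, rfl⟩ := Finset.mem_image.1 hy
      exact hball (hx j t ht)
    · intro y hy y' hy' hne
      obtain ⟨j, hj, rfl⟩ := Finset.mem_image.1 hy
      obtain ⟨j', hj', rfl⟩ := Finset.mem_image.1 hy'
      exact hsep' j hj j' hj' fun h => hne (by rw [h])
  -- Each of the `M` iterations is charged to exactly one of the `T` stages.
  have hfiber := Finset.card_eq_sum_card_fiberwise (f := τ) (s := Finset.range M)
    (t := Finset.range P.T) fun j hj => by
      simpa using (hτ j (by simpa using hj)).1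
  rw [Finset.card_range] at hfiber
  rw [hfiber, Nat.cast_sum]
  exact (Finset.sum_le_sum hcard).trans_eq (by simp)

end StagewiseProgram

end

/-! ### The complexity theorem. -/

theorem mainTheorem3
    {E : ℕ → Type*} [∀ t, NormedAddCommGroup (E t)] [∀ t, NormedSpace ℝ (E t)]
    [∀ t, FiniteDimensional ℝ (E t)]
    {N : ℕ → Type*} [∀ t, Fintype (N t)]
    {Yr : Type*} [NormedAddCommGroup Yr] [NormedSpace ℝ Yr] [FiniteDimensional ℝ Yr]
    {Y : ∀ t, N t → Type*} [∀ t m, NormedAddCommGroup (Y t m)] [∀ t m, NormedSpace ℝ (Y t m)]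
    [∀ t m, FiniteDimensional ℝ (Y t m)]
    (P : StagewiseProgram E N Yr Y)
    (hT : 1 ≤ P.T)
    (hmin : P.MinCondition) (hpen : P.PenaltyCondition) (hexact : P.ExactPenalty)
    (hdual : P.DualBoundCondition)
    (O : P.Oracles) (S : StagewiseProgram.SelectionRule N)
    (L D ε : ℝ) (d : ℕ)
    (hL : ∀ t < P.T, P.lipConst t ≤ L)
    (hd : ∀ t < P.T, Module.finrank ℝ (E t) ≤ d)
    (hD : ∀ t < P.T, ∃ (c : E t) (r : ℝ), P.X t ⊆ Metric.closedBall c r ∧ 2 * r ≤ D)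
    (hε : 0 < ε) :
    ∃ i : ℕ, O.TerminatesAfter S (P.T * ε) i ∧
      (i : ℝ) ≤ P.T * (1 + 2 * L * D / ε) ^ d ∧
      P.IsOptimalRoot (P.T * ε) (O.run S i).best := by
  classical
  -- This bounds every `M` whose first `M` loop tests fail. It yields both termination and, at the
  -- first successful test, the bound on the number of iterations.
  have hbound := fun M =>
    O.card_le_of_not_terminated (M := M) S hT hmin hpen hexact hdual hL hd hD hε
  have hex : ∃ i, (O.run S i).upper - (O.run S i).lower ≤ ((P.T * ε : ℝ) : EReal) := by
    by_contra! h
    obtain ⟨M, hM⟩ := exists_nat_gt (P.T * (1 + 2 * L * D / ε) ^ d)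
    exact absurd (hbound M fun j _ => not_le.2 (h j)) (not_le.2 hM)
  have hlt : ∀ j < Nat.find hex, ¬(O.run S j).upper - (O.run S j).lower ≤
      ((P.T * ε : ℝ) : EReal) := fun j hj => Nat.find_min hex hj
  exact ⟨Nat.find hex, ⟨fun j hj => not_le.1 (hlt j hj), Nat.find_spec hex⟩, hbound _ hlt,
    (O.valid_run hT hmin hpen S _).isOptimalRoot_best hT hmin hpen hexact (by positivity)
      (Nat.find_spec hex)⟩
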